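/- For $d\ge 1$ let $\pi=N(0,I_d)$ be the standard Gaussian distribution on $\mathbb R^d$, with potential $V(x)=\|x\|^2/2$. MALA with step size $h>0$ is the Markov chain $(x_n)_{n\ge 0}$ that, from $x_n=x$, draws a proposal $y$ from the density $Q(x,y)=(4\pi h)^{-d/2}\exp\bigl(-\|y-x+h\nabla V(x)\|^2/(4h)\bigr)$ (in this formula $\pi$ is the number) and sets $x_{n+1}=y$ with probability $\min\bigl\{1,\frac{e^{-V(y)}Q(y,x)}{e^{-V(x)}Q(x,y)}\bigr\}$ and $x_{n+1}=x$ otherwise. Let $\mu_n$ be the law of $x_n$ when $x_0\sim\mu_0$, let $\mathrm{TV}(\mu,\nu)=\sup_E|\mu(E)-\nu(E)|$, the supremum being over Borel sets $E$, and let $\tau_{\rm mix}(\varepsilon,\mu_0;\mathrm{TV})=\inf\{n\in\mathbb N:\mathrm{TV}(\mu_n,\pi)\le\varepsilon\}$. A probability measure $\mu_0$ is $M_0$-warm if $\mu_0(E)\le M_0\,\pi(E)$ for every Borel set $E$. Proposition. There is an absolute constant $c_0>0$ such that for every $c\in(0,c_0]$ and every $K\in\mathbb R$ there is a constant $C>0$,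 depending only on $c$ and $K$, with the following property. For every $d\ge1$, every $M_0$ and $\varepsilon$ with $0<\varepsilon\le M_0$, and every $M_0$-warm probability measure $\mu_0$ on $\mathbb R^d$, if $h=c\,d^{-1/3}$ and $$\log\frac{M_0}{\varepsilon h}\le K\,d^{1/3},$$ then the mixing time of MALA with target $\pi$, step size $h$ and initial distribution $\mu_0$ is finite and satisfies $$\tau_{\rm mix}(\varepsilon,\mu_0;\mathrm{TV})\le C\,d^{1/3}\log\frac{M_0}{\varepsilon}.$$ -/

import Mathlib

open MeasureTheory ProbabilityTheory
open scoped ENNReal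

noncomputable section

namespace MALA

variable {d : ℕ}

/-- Density `Q(x, y)` at `y` of the Langevin proposal started at `x`, i.e. of the Gaussian
`N(x - h ∇V(x), 2h I_d)`. -/
def proposalDensity (V : EuclideanSpace ℝ (Fin d) → ℝ) (h : ℝ) (x y : EuclideanSpace ℝ (Fin d)) :
    ℝ :=
  1 / (4 * Real.pi * h) ^ ((d : ℝ) / 2) * Real.exp (-‖y - x + h • gradient V x‖ ^ 2 / (4 * h))

/-- The ratio `a(x, y) = π(y) Q(y, x) / (π(x) Q(x, y))` for the target density `π ∝ exp (-V)`;
the normalizing constant of `π` cancels. -/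
def acceptRatio (V : EuclideanSpace ℝ (Fin d) → ℝ) (h : ℝ) (x y : EuclideanSpace ℝ (Fin d)) : ℝ :=
  (Real.exp (-V y) * proposalDensity V h y x) / (Real.exp (-V x) * proposalDensity V h x y)

/-- The acceptance probability `A(x, y) = 1 ∧ a(x, y)` of a proposed move from `x` to `y`. -/
def acceptProb (V : EuclideanSpace ℝ (Fin d) → ℝ) (h : ℝ) (x y : EuclideanSpace ℝ (Fin d)) : ℝ :=
  min 1 (acceptRatio V h x y)

/-- The overall acceptance probability `A(x) = ∫ Q(x, y) A(x, y) dy` at `x`. -/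
def acceptMass (V : EuclideanSpace ℝ (Fin d) → ℝ) (h : ℝ) (x : EuclideanSpace ℝ (Fin d)) : ℝ≥0∞ :=
  ∫⁻ y, ENNReal.ofReal (proposalDensity V h x y * acceptProb V h x y)

theorem measurable_proposalDensity {V : EuclideanSpace ℝ (Fin d) → ℝ} (hV : ContDiff ℝ 2 V)
    (h : ℝ) : Measurable fun p : EuclideanSpace ℝ (Fin d) × EuclideanSpace ℝ (Fin d) =>
      proposalDensity V h p.1 p.2 := by
  have hg : Continuous (gradient V) :=
    (InnerProductSpace.toDual ℝ (EuclideanSpace ℝ (Fin d))).symm.continuous.comp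
      (hV.continuous_fderiv (by norm_num))
  have hc : Continuous fun p : EuclideanSpace ℝ (Fin d) × EuclideanSpace ℝ (Fin d) =>
      proposalDensity V h p.1 p.2 := by
    unfold proposalDensity
    fun_prop
  exact hc.measurable

theorem measurable_accepted {V : EuclideanSpace ℝ (Fin d) → ℝ} (hV : ContDiff ℝ 2 V) (h : ℝ) :
    Measurable fun p : EuclideanSpace ℝ (Fin d) × EuclideanSpace ℝ (Fin d) =>
      ENNReal.ofReal (proposalDensity V h p.1 p.2 * acceptProb V h p.1 p.2) := by
  have hq := measurable_proposalDensity hV h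
  have hv : Measurable V := hV.continuous.measurable
  unfold acceptProb acceptRatio
  generalize proposalDensity V h = q at hq ⊢
  have hq' : Measurable fun p : EuclideanSpace ℝ (Fin d) × EuclideanSpace ℝ (Fin d) =>
      q p.2 p.1 := hq.comp measurable_swap
  exact (hq.mul (measurable_const.min
    (((hv.comp measurable_snd).neg.exp.mul hq').div
      ((hv.comp measurable_fst).neg.exp.mul hq)))).ennreal_ofReal

/-- The transition kernel of MALA with potential `V` and step size `h`:
`T(x, dy) = Q(x, y) A(x, y) dy + (1 - A(x)) δ_x(dy)`. -/
def kernel (V : EuclideanSpace ℝ (Fin d) → ℝ) (hV : ContDiff ℝ 2 V) (h : ℝ) :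
    Kernel (EuclideanSpace ℝ (Fin d)) (EuclideanSpace ℝ (Fin d)) where
  toFun x := volume.withDensity
      (fun y => ENNReal.ofReal (proposalDensity V h x y * acceptProb V h x y))
    + (1 - acceptMass V h x) • Measure.dirac x
  measurable' := by
    have hm := measurable_accepted hV h
    refine Measure.measurable_of_measurable_coe _ fun s hs => ?_
    simp only [Measure.coe_add, Pi.add_apply, Measure.smul_apply, smul_eq_mul,
      withDensity_apply _ hs, Measure.dirac_apply' _ hs]
    refine Measurable.add hm.lintegral_prod_right' (Measurable.mul ?_ ?_)
    · exact measurable_const.sub hm.lintegral_prod_right'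
    · exact measurable_one.indicator hs

/-- The law `μ_n` of the `n`-th iterate of a Markov chain with kernel `T` and initial law `μ₀`. -/
def law {α : Type*} [MeasurableSpace α] (T : Kernel α α) (μ₀ : Measure α) : ℕ → Measure α
  | 0 => μ₀
  | n + 1 => (law T μ₀ n).bind T

/-- Total variation distance `sup_E |μ(E) - ν(E)|` over measurable sets `E`. -/
def tvDist {α : Type*} [MeasurableSpace α] (μ ν : Measure α) : ℝ :=
  ⨆ E : {E : Set α // MeasurableSet E}, |μ.real E - ν.real E|

/-- The mixing time `inf {n | TV(μ_n, π) ≤ ε}`, equal to `⊤` if there is no such `n`. -/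
def mixingTime {α : Type*} [MeasurableSpace α] (T : Kernel α α) (π μ₀ : Measure α) (ε : ℝ) : ℕ∞ :=
  ⨅ n ∈ {n : ℕ | tvDist (law T μ₀ n) π ≤ ε}, (n : ℕ∞)

/-- `μ₀` is `M₀`-warm with respect to `π`. -/
def IsWarm {α : Type*} [MeasurableSpace α] (M₀ : ℝ) (μ₀ π : Measure α) : Prop :=
  ∀ E : Set α, MeasurableSet E → μ₀ E ≤ ENNReal.ofReal M₀ * π E

/-- The potential `V(x) = ‖x‖² / 2` of the standard Gaussian on `ℝ^d`. -/
def gaussianPotential (d : ℕ) (x : EuclideanSpace ℝ (Fin d)) : ℝ := ‖x‖ ^ 2 / 2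

theorem contDiff_gaussianPotential (d : ℕ) : ContDiff ℝ 2 (gaussianPotential d) :=
  (contDiff_norm_sq ℝ).div_const 2

/-- The MALA kernel with step size `h` for the standard Gaussian target on `ℝ^d`. -/
def gaussianKernel (d : ℕ) (h : ℝ) :
    Kernel (EuclideanSpace ℝ (Fin d)) (EuclideanSpace ℝ (Fin d)) :=
  kernel (gaussianPotential d) (contDiff_gaussianPotential d) h

end MALA

end

/-! Write `γ` for the standard Gaussian measure and `P` for the MALA operator. For this target the
acceptance ratio is `a(x, y) = exp (-(h/4) (‖y‖² - ‖x‖²))`, so all the integrals that matter are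
explicit Gaussian ones.

Contraction. `P` is reversible and also positive semidefinite: the joint density of an accepted move
is a mixture of products `u(x) u(y)`, and rejection only adds a nonnegative multiplication operator.
Hence `‖P f‖² ≤ ⟨f, P f⟩`, and one step lowers the variance of the density of the current law by at
least its Dirichlet form, with no need of a lazy chain. If `Var f` is at most `1/ρ` times the
Dirichlet form plus a defect `δ M²`, for all `f` with values in `[0, M]`, then the chi-square
distance after `n` steps is at most `(1 - ρ)^n M² + δ M²` (`tvDist_law_le`). Densities of warm laws
stay in `[0, M]` along the chain, so bounded functions suffice.

Approximate Poincaré inequality (`variance_le_barkerEnergy`), with `ρ` of order `h`. The Metropolis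
factor `min 1 a` is replaced by the smaller, smooth Barker factor `1 / (1 + 1/a)`. Let `g(x)` be the
average of `f` over the Barker moves from `x`. The local energy of `f` at `x` controls `(f - g)²`,
and through Cauchy–Schwarz and a Fisher information of order `1/h` it controls `‖∇g‖²`. The Gaussian
Poincaré inequality for `g` then bounds the variance of `f`. The price is a power of the inverse
Barker mass at `x`. By Jensen this mass is at least `1 / (1 + s(x))` with `s(x) = ∫ Q(x, w) / a(x,
w) dw`, and `s(x) ≤ exp (h³ d + h² L / 2)` as soon as `‖x‖² ≥ d - L`. The remaining points have
`γ`-measure at most `exp (-L² / (4 d))` and produce the defect.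

Scaling. With `h = c d^(-1/3)` and `L = B d^(2/3)` both `h³ d` and `h² L` are bounded, while the
exceptional measure is `exp (-B² d^(1/3) / 4)`. The hypothesis on `log (M₀ / (ε h))` says exactly
that a large `B`, depending on `K` only, makes the defect smaller than `ε² / 2`. -/

noncomputable section

namespace MALA

set_option linter.unusedSectionVars false

/-! ### Isotropic Gaussian densities and their integrals. -/

section GaussianDensity

variable {E : Type*} [NormedAddCommGroup E] [InnerProductSpace ℝ E] [FiniteDimensional ℝ E]
  [MeasurableSpace E] [BorelSpace E]

/-- The density of the centred isotropic Gaussian with variance `s` in each direction. -/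
def gaussianDensity (s : ℝ) (v : E) : ℝ :=
  ((2 * Real.pi * s) ^ ((Module.finrank ℝ E : ℝ) / 2))⁻¹ * Real.exp (-‖v‖ ^ 2 / (2 * s))

theorem gaussianDensity_pos {s : ℝ} (hs : 0 < s) (v : E) : 0 < gaussianDensity s v := by
  unfold gaussianDensity
  positivity

theorem continuous_gaussianDensity (s : ℝ) : Continuous (gaussianDensity s : E → ℝ) := by
  unfold gaussianDensity
  fun_prop

theorem integrable_exp_neg_mul_sq_norm {b : ℝ} (hb : 0 < b) :
    Integrable fun v : E => Real.exp (-b * ‖v‖ ^ 2) := by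
  have h := (GaussianFourier.integrable_cexp_neg_mul_sq_norm_add (V := E) (b := (b : ℂ))
    (by simpa using hb) 0 0).re
  refine h.congr (ae_of_all _ fun v => ?_)
  simp only [zero_mul, add_zero]
  rw [show -(b : ℂ) * (‖v‖ : ℂ) ^ 2 = ((-b * ‖v‖ ^ 2 : ℝ) : ℂ) by push_cast; ring]
  exact Complex.exp_ofReal_re _

theorem integrable_gaussianDensity {s : ℝ} (hs : 0 < s) :
    Integrable (gaussianDensity s : E → ℝ) := by
  unfold gaussianDensity
  refine Integrable.const_mul ?_ _
  have := integrable_exp_neg_mul_sq_norm (E := E) (b := 1 / (2 * s)) (by positivity)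
  refine this.congr (ae_of_all _ fun v => ?_)
  simp only
  congr 1
  ring

theorem integral_gaussianDensity {s : ℝ} (hs : 0 < s) :
    ∫ v : E, gaussianDensity s v = 1 := by
  unfold gaussianDensity
  rw [integral_const_mul]
  have := GaussianFourier.integral_rexp_neg_mul_sq_norm (V := E) (b := 1 / (2 * s)) (by positivity)
  have h2 : ∀ v : E, -‖v‖ ^ 2 / (2 * s) = -(1 / (2 * s)) * ‖v‖ ^ 2 := fun v => by ring
  simp_rw [h2, this]
  rw [show Real.pi / (1 / (2 * s)) = 2 * Real.pi * s by field_simp]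
  exact inv_mul_cancel₀ (by positivity)

/-- Both sides are finite measures with the same characteristic function. This ties the abstract
standard Gaussian to an explicit density. -/
theorem withDensity_gaussianDensity_one :
    (volume : Measure E).withDensity (fun v => ENNReal.ofReal (gaussianDensity 1 v))
      = stdGaussian E := by
  have hm : Measurable fun v : E => ENNReal.ofReal (gaussianDensity 1 v) :=
    (continuous_gaussianDensity 1).measurable.ennreal_ofReal
  have : IsFiniteMeasure
      ((volume : Measure E).withDensity (fun v => ENNReal.ofReal (gaussianDensity 1 v))) :=
    isFiniteMeasure_withDensity_ofReal (integrable_gaussianDensity one_pos).hasFiniteIntegral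
  apply Measure.ext_of_charFun
  ext t
  rw [charFun_stdGaussian, charFun_apply, integral_withDensity_eq_integral_toReal_smul hm
    (ae_of_all _ fun _ => ENNReal.ofReal_lt_top)]
  have h1 : ∀ v : E, (ENNReal.ofReal (gaussianDensity 1 v)).toReal •
        Complex.exp ((inner ℝ v t : ℝ) * Complex.I)
      = (((2 * Real.pi) ^ ((Module.finrank ℝ E : ℝ) / 2))⁻¹ : ℝ) *
        Complex.exp (-(1 / 2 : ℂ) * ‖v‖ ^ 2 + Complex.I * (inner ℝ t v : ℝ)) := by
    intro v
    rw [ENNReal.toReal_ofReal (gaussianDensity_pos one_pos v).le, Complex.real_smul,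
      gaussianDensity, Complex.exp_add, real_inner_comm]
    push_cast
    rw [mul_one, mul_comm Complex.I, ← mul_assoc]
    congr 3
    ring
  simp_rw [h1]
  rw [integral_const_mul, GaussianFourier.integral_cexp_neg_mul_sq_norm_add (by norm_num),
    ← mul_assoc]
  have h2 : ((Real.pi : ℂ) / (1 / 2)) ^ ((Module.finrank ℝ E : ℂ) / 2)
      = (((2 * Real.pi) ^ ((Module.finrank ℝ E : ℝ) / 2) : ℝ) : ℂ) := by
    rw [Complex.ofReal_cpow (by positivity)]
    push_cast
    congr 1
    ring
  rw [h2, ← Complex.ofReal_mul, inv_mul_cancel₀ (by positivity)]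
  simp only [Complex.ofReal_one, one_mul, Complex.I_sq]
  congr 1
  ring

theorem integral_stdGaussian_eq (φ : E → ℝ) :
    ∫ z, φ z ∂(stdGaussian E) = ∫ z, gaussianDensity 1 z * φ z := by
  rw [← withDensity_gaussianDensity_one, integral_withDensity_eq_integral_toReal_smul
    (continuous_gaussianDensity 1).measurable.ennreal_ofReal
    (ae_of_all _ fun _ => ENNReal.ofReal_lt_top)]
  refine integral_congr_ae (ae_of_all _ fun v => ?_)
  simp only [smul_eq_mul]
  rw [ENNReal.toReal_ofReal (gaussianDensity_pos one_pos v).le]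

theorem lintegral_stdGaussian_eq {φ : E → ℝ≥0∞} (hφ : Measurable φ) :
    ∫⁻ z, φ z ∂(stdGaussian E) = ∫⁻ z, ENNReal.ofReal (gaussianDensity 1 z) * φ z := by
  rw [← withDensity_gaussianDensity_one, lintegral_withDensity_eq_lintegral_mul _
    (continuous_gaussianDensity 1).measurable.ennreal_ofReal hφ]
  rfl

theorem gaussianDensity_smul {s : ℝ} (hs : 0 < s) (z : E) :
    gaussianDensity s (Real.sqrt s • z)
      = ((Real.sqrt s) ^ Module.finrank ℝ E)⁻¹ * gaussianDensity 1 z := by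
  unfold gaussianDensity
  rw [norm_smul, mul_pow, Real.norm_eq_abs, sq_abs, Real.sq_sqrt hs.le, mul_one, mul_one,
    Real.mul_rpow (by positivity) hs.le, mul_inv,
    show -(s * ‖z‖ ^ 2) / (2 * s) = -‖z‖ ^ 2 / 2 by field_simp]
  have : s ^ ((Module.finrank ℝ E : ℝ) / 2) = Real.sqrt s ^ Module.finrank ℝ E := by
    rw [Real.sqrt_eq_rpow, ← Real.rpow_natCast, ← Real.rpow_mul hs.le]
    congr 1
    ring
  rw [this]
  ring

theorem integral_gaussianDensity_mul {s : ℝ} (hs : 0 < s) (φ : E → ℝ) :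
    ∫ v, gaussianDensity s v * φ v = ∫ z, φ (Real.sqrt s • z) ∂(stdGaussian E) := by
  rw [integral_stdGaussian_eq]
  have h := Measure.integral_comp_smul (volume : Measure E)
    (fun v => gaussianDensity s v * φ v) (Real.sqrt s)
  simp_rw [gaussianDensity_smul hs, mul_assoc] at h
  rw [integral_const_mul, abs_of_pos (by positivity), smul_eq_mul] at h
  exact (mul_left_cancel₀ (by positivity) h).symm

theorem integral_gaussianDensity_sub_mul {s : ℝ} (hs : 0 < s) (a : E) (φ : E → ℝ) :
    ∫ v, gaussianDensity s (v - a) * φ v = ∫ z, φ (a + Real.sqrt s • z) ∂(stdGaussian E) := by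
  rw [← integral_gaussianDensity_mul hs (fun v => φ (a + v)),
    ← integral_add_right_eq_self _ a]
  simp [add_comm]

theorem integral_inner_sq_stdGaussian (u : E) :
    ∫ z, (inner ℝ z u) ^ 2 ∂(stdGaussian E) = ‖u‖ ^ 2 := by
  have h := variance_dual_stdGaussian (innerSL ℝ u)
  rw [variance_eq_sub] at h
  · have h0 := integral_strongDual_stdGaussian (innerSL ℝ u)
    rw [h0] at h
    simp only [innerSL_apply_norm] at h
    rw [← h]
    simp [real_inner_comm]
  · exact IsGaussian.memLp_dual _ _ _ (by simp)

theorem integrable_inner_sq_stdGaussian (u : E) :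
    Integrable (fun z => (inner ℝ z u) ^ 2) (stdGaussian E) := by
  have : MemLp (innerSL ℝ u) 2 (stdGaussian E) := IsGaussian.memLp_dual _ _ _ (by simp)
  simpa [real_inner_comm] using this.integrable_sq

/-- `∫ exp (-b ‖v‖² + ⟨w, v⟩) dv`. -/
theorem integral_exp_neg_mul_sq_norm_add_inner {b : ℝ} (hb : 0 < b) (w : E) :
    ∫ v : E, Real.exp (-b * ‖v‖ ^ 2 + inner ℝ w v)
      = (Real.pi / b) ^ ((Module.finrank ℝ E : ℝ) / 2) * Real.exp (‖w‖ ^ 2 / (4 * b)) := by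
  have h0 : ∀ v : E, -b * ‖v‖ ^ 2 + inner ℝ w v
      = ‖w‖ ^ 2 / (4 * b) + -b * ‖v - (1 / (2 * b)) • w‖ ^ 2 := by
    intro v
    rw [norm_sub_sq_real, norm_smul, inner_smul_right, real_inner_comm, mul_pow,
      Real.norm_eq_abs, sq_abs]
    field_simp
    ring
  simp_rw [h0, Real.exp_add]
  rw [integral_const_mul, integral_sub_right_eq_self (fun v => Real.exp (-b * ‖v‖ ^ 2)),
    GaussianFourier.integral_rexp_neg_mul_sq_norm hb, mul_comm]

theorem integrable_exp_neg_mul_sq_norm_add_inner {b : ℝ} (hb : 0 < b) (w : E) :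
    Integrable fun v : E => Real.exp (-b * ‖v‖ ^ 2 + inner ℝ w v) := by
  have h0 : ∀ v : E, -b * ‖v‖ ^ 2 + inner ℝ w v
      = ‖w‖ ^ 2 / (4 * b) + -b * ‖v - (1 / (2 * b)) • w‖ ^ 2 := by
    intro v
    rw [norm_sub_sq_real, norm_smul, inner_smul_right, real_inner_comm, mul_pow,
      Real.norm_eq_abs, sq_abs]
    field_simp
    ring
  simp_rw [h0, Real.exp_add]
  exact ((integrable_exp_neg_mul_sq_norm hb).comp_sub_right _).const_mul _

end GaussianDensity

/-! ### Reversible Markov kernels acting on bounded functions. -/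

section Chain

variable {α : Type*} [MeasurableSpace α] {γ : Measure α} [IsProbabilityMeasure γ]
  {κ : Kernel α α} [IsMarkovKernel κ]

/-- The action of a Markov kernel on functions. -/
def kernelMap (κ : Kernel α α) (f : α → ℝ) (x : α) : ℝ := ∫ y, f y ∂(κ x)

theorem measurable_kernelMap {f : α → ℝ} (hf : Measurable f) : Measurable (kernelMap κ f) :=
  (hf.stronglyMeasurable.integral_kernel (κ := κ)).measurable

theorem integrable_of_abs_le {β : Type*} [MeasurableSpace β] {μ : Measure β} [IsFiniteMeasure μ]
    {f : β → ℝ} (hf : Measurable f) {M : ℝ} (hM : ∀ x, |f x| ≤ M) : Integrable f μ :=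
  Integrable.of_bound hf.aestronglyMeasurable M (ae_of_all _ hM)

theorem kernelMap_mem_Icc {f : α → ℝ} (hf : Measurable f) {a b : ℝ}
    (h : ∀ x, f x ∈ Set.Icc a b) (x : α) : kernelMap κ f x ∈ Set.Icc a b := by
  have hi : Integrable f (κ x) := integrable_of_abs_le hf (M := max |a| |b|) fun x =>
    abs_le_max_abs_abs (h x).1 (h x).2
  constructor
  · have := integral_mono (integrable_const a) hi fun y => (h y).1
    rwa [integral_const, probReal_univ, one_smul] at this
  · have := integral_mono hi (integrable_const b) fun y => (h y).2
    rwa [integral_const, probReal_univ, one_smul] at this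

theorem abs_kernelMap_le {f : α → ℝ} (hf : Measurable f) {M : ℝ} (hM : ∀ x, |f x| ≤ M) (x : α) :
    |kernelMap κ f x| ≤ M :=
  abs_le.2 (kernelMap_mem_Icc hf (fun x => abs_le.1 (hM x)) x)

/-- Reversibility is this symmetry on rectangles, and rectangles determine a finite measure on the
product. Self-adjointness of the operator follows from it. -/
theorem map_swap_compProd (hrev : κ.IsReversible γ) :
    (γ ⊗ₘ κ).map Prod.swap = γ ⊗ₘ κ := by
  have : IsProbabilityMeasure ((γ ⊗ₘ κ).map Prod.swap) :=
    Measure.isProbabilityMeasure_map measurable_swap.aemeasurable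
  refine Measure.ext_prod fun {s t} hs ht => ?_
  rw [Measure.map_apply measurable_swap (hs.prod ht), Set.preimage_swap_prod,
    Measure.compProd_apply_prod ht hs, Measure.compProd_apply_prod hs ht]
  exact hrev ht hs

theorem integral_compProd_swap (hrev : κ.IsReversible γ) {f : α × α → ℝ} (hf : Measurable f) :
    ∫ p, f p.swap ∂(γ ⊗ₘ κ) = ∫ p, f p ∂(γ ⊗ₘ κ) := by
  conv_rhs => rw [← map_swap_compProd hrev]
  rw [integral_map measurable_swap.aemeasurable hf.aestronglyMeasurable]

theorem integral_mul_kernelMap {f g : α → ℝ} (hf : Measurable f) (hg : Measurable g) {M N : ℝ}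
    (hM : ∀ x, |f x| ≤ M) (hN : ∀ x, |g x| ≤ N) :
    ∫ x, f x * kernelMap κ g x ∂γ = ∫ p, f p.1 * g p.2 ∂(γ ⊗ₘ κ) := by
  have hi : Integrable (fun p : α × α => f p.1 * g p.2) (γ ⊗ₘ κ) := by
    refine integrable_of_abs_le (by fun_prop) (M := M * N) fun p => ?_
    rw [abs_mul]
    exact mul_le_mul (hM _) (hN _) (abs_nonneg _) ((abs_nonneg _).trans (hM p.1))
  rw [Measure.integral_compProd hi]
  simp_rw [integral_const_mul]
  rfl

theorem integral_mul_kernelMap_comm (hrev : κ.IsReversible γ) {f g : α → ℝ} (hf : Measurable f)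
    (hg : Measurable g) {M N : ℝ} (hM : ∀ x, |f x| ≤ M) (hN : ∀ x, |g x| ≤ N) :
    ∫ x, f x * kernelMap κ g x ∂γ = ∫ x, g x * kernelMap κ f x ∂γ := by
  rw [integral_mul_kernelMap hf hg hM hN, integral_mul_kernelMap hg hf hN hM,
    ← integral_compProd_swap hrev (by fun_prop)]
  simp only [Prod.fst_swap, Prod.snd_swap, mul_comm]

theorem integral_kernelMap (hrev : κ.IsReversible γ) {f : α → ℝ} (hf : Measurable f) {M : ℝ}
    (hM : ∀ x, |f x| ≤ M) : ∫ x, kernelMap κ f x ∂γ = ∫ x, f x ∂γ := by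
  have h := integral_mul_kernelMap_comm hrev (f := fun _ => 1) measurable_const hf (M := 1)
    (by simp) hM
  simpa [kernelMap] using h

/-- The Dirichlet form of a reversible kernel. -/
def dirichletForm (γ : Measure α) (κ : Kernel α α) (f : α → ℝ) : ℝ :=
  1 / 2 * ∫ x, ∫ y, (f y - f x) ^ 2 ∂(κ x) ∂γ

theorem dirichletForm_eq (hrev : κ.IsReversible γ) {f : α → ℝ} (hf : Measurable f) {M : ℝ}
    (hM : ∀ x, |f x| ≤ M) :
    dirichletForm γ κ f = ∫ x, f x ^ 2 ∂γ - ∫ x, f x * kernelMap κ f x ∂γ := by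
  have hM0 : ∀ x : α, 0 ≤ M := fun x => (abs_nonneg _).trans (hM x)
  have hsq : ∀ x, |f x ^ 2| ≤ M ^ 2 := fun x => by
    rw [abs_pow]; exact pow_le_pow_left₀ (abs_nonneg _) (hM x) 2
  have hi1 : Integrable (fun p : α × α => f p.1 ^ 2) (γ ⊗ₘ κ) :=
    integrable_of_abs_le (by fun_prop) fun p => hsq p.1
  have hi2 : Integrable (fun p : α × α => f p.2 ^ 2) (γ ⊗ₘ κ) :=
    integrable_of_abs_le (by fun_prop) fun p => hsq p.2
  have hi3 : Integrable (fun p : α × α => f p.1 * f p.2) (γ ⊗ₘ κ) := by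
    refine integrable_of_abs_le (by fun_prop) (M := M * M) fun p => ?_
    rw [abs_mul]
    exact mul_le_mul (hM _) (hM _) (abs_nonneg _) (hM0 p.1)
  have hexp : (fun p : α × α => (f p.2 - f p.1) ^ 2)
      = fun p => (f p.1 ^ 2 + f p.2 ^ 2) - 2 * (f p.1 * f p.2) := by
    funext p; ring
  have hi : Integrable (fun p : α × α => (f p.2 - f p.1) ^ 2) (γ ⊗ₘ κ) := by
    rw [hexp]; exact (hi1.add hi2).sub (hi3.const_mul 2)
  have h1 : ∫ p : α × α, f p.1 ^ 2 ∂(γ ⊗ₘ κ) = ∫ x, f x ^ 2 ∂γ := by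
    rw [Measure.integral_compProd hi1]
    simp
  have h2 : ∫ p : α × α, f p.2 ^ 2 ∂(γ ⊗ₘ κ) = ∫ x, f x ^ 2 ∂γ := by
    rw [← h1, ← integral_compProd_swap hrev (by fun_prop)]
    rfl
  rw [dirichletForm, ← Measure.integral_compProd (f := fun p : α × α => (f p.2 - f p.1) ^ 2) hi,
    hexp, integral_sub (by exact hi1.add hi2) (hi3.const_mul 2), integral_add hi1 hi2, h1, h2,
    integral_const_mul, integral_mul_kernelMap hf hf hM hM]
  ring

theorem dirichletForm_nonneg (f : α → ℝ) : 0 ≤ dirichletForm γ κ f :=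
  mul_nonneg (by norm_num) (integral_nonneg fun _ => integral_nonneg fun _ => sq_nonneg _)

/-- For a positive semidefinite reversible kernel, `‖κ f‖² ≤ ⟨f, κ f⟩`. -/
theorem integral_kernelMap_sq_le (hrev : κ.IsReversible γ)
    (hpos : ∀ F : α → ℝ, Measurable F → (∃ M, ∀ x, |F x| ≤ M) →
      0 ≤ ∫ x, F x * kernelMap κ F x ∂γ)
    {f : α → ℝ} (hf : Measurable f) {M : ℝ} (hM : ∀ x, |f x| ≤ M) :
    ∫ x, kernelMap κ f x ^ 2 ∂γ ≤ ∫ x, f x * kernelMap κ f x ∂γ := by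
  set g := kernelMap κ f with hg
  have hgm : Measurable g := measurable_kernelMap hf
  have hgM : ∀ x, |g x| ≤ M := abs_kernelMap_le hf hM
  have hggm : Measurable (kernelMap κ g) := measurable_kernelMap hgm
  have hggM : ∀ x, |kernelMap κ g x| ≤ M := abs_kernelMap_le hgm hgM
  have hsub : kernelMap κ (fun x => f x - g x) = fun x => g x - kernelMap κ g x := by
    funext x
    exact integral_sub (integrable_of_abs_le hf hM) (integrable_of_abs_le hgm hgM)
  -- Positivity is applied to `f - κ f`. With self-adjointness it reads `0 ≤ ⟨f, g⟩ - 2 ‖g‖² + ⟨g, κ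
  -- g⟩`, and `⟨g, κ g⟩ ≤ ‖g‖²` because the Dirichlet form of `g` is nonnegative.
  have h0 := hpos (fun x => f x - g x) (hf.sub hgm)
    ⟨M + M, fun x => (abs_sub _ _).trans (add_le_add (hM x) (hgM x))⟩
  rw [hsub] at h0
  have hmul : ∀ {u v : α → ℝ}, Measurable u → Measurable v → (∀ x, |u x| ≤ M) →
      (∀ x, |v x| ≤ M) → Integrable (fun x => u x * v x) γ := by
    intro u v hu hv hu' hv'
    refine integrable_of_abs_le (by fun_prop) (M := M * M) fun p => ?_
    rw [abs_mul]
    exact mul_le_mul (hu' _) (hv' _) (abs_nonneg _) ((abs_nonneg _).trans (hu' p))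
  have hexp : (fun x => (f x - g x) * (g x - kernelMap κ g x))
      = fun x => (f x * g x - f x * kernelMap κ g x) - (g x * g x - g x * kernelMap κ g x) := by
    funext x; ring
  have e1 : ∫ x, f x * kernelMap κ g x ∂γ = ∫ x, g x * g x ∂γ :=
    integral_mul_kernelMap_comm hrev hf hgm hM hgM
  have e2 := dirichletForm_eq hrev hgm hgM
  have e3 := dirichletForm_nonneg (γ := γ) (κ := κ) g
  rw [hexp, integral_sub (by exact (hmul hf hgm hM hgM).sub (hmul hf hggm hM hggM))
    (by exact (hmul hgm hgm hgM hgM).sub (hmul hgm hggm hgM hggM)),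
    integral_sub (hmul hf hgm hM hgM) (hmul hf hggm hM hggM),
    integral_sub (hmul hgm hgm hgM hgM) (hmul hgm hggm hgM hggM), e1] at h0
  simp only [pow_two] at e2 ⊢
  linarith

/-- One step of a reversible chain acts on densities through the kernel. -/
theorem withDensity_bind (hrev : κ.IsReversible γ) {f : α → ℝ} (hf : Measurable f) {M : ℝ}
    (h0 : ∀ x, 0 ≤ f x) (hM : ∀ x, f x ≤ M) :
    (γ.withDensity fun x => ENNReal.ofReal (f x)).bind κ
      = γ.withDensity fun x => ENNReal.ofReal (kernelMap κ f x) := by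
  have hfm : Measurable fun x => ENNReal.ofReal (f x) := hf.ennreal_ofReal
  have hT : ∀ x, ENNReal.ofReal (kernelMap κ f x) = ∫⁻ y, ENNReal.ofReal (f y) ∂(κ x) := by
    intro x
    refine ofReal_integral_eq_lintegral_ofReal ?_ (ae_of_all _ h0)
    exact integrable_of_abs_le hf fun x => abs_le.2 ⟨by linarith [h0 x, hM x], hM x⟩
  ext s hs
  have hind : Measurable (s.indicator (1 : α → ℝ≥0∞)) := measurable_one.indicator hs
  rw [Measure.bind_apply hs (Kernel.aemeasurable _), withDensity_apply _ hs,
    lintegral_withDensity_eq_lintegral_mul _ hfm (Kernel.measurable_coe κ hs)]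
  simp_rw [hT]
  have hA : ∫⁻ x, ((fun x => ENNReal.ofReal (f x)) * fun x => κ x s) x ∂γ
      = ∫⁻ p, ENNReal.ofReal (f p.1) * s.indicator 1 p.2 ∂(γ ⊗ₘ κ) := by
    rw [Measure.lintegral_compProd (by fun_prop)]
    refine lintegral_congr fun x => ?_
    dsimp only [Pi.mul_apply]
    rw [lintegral_const_mul _ hind, lintegral_indicator_one hs]
  have hB : ∫⁻ x in s, ∫⁻ y, ENNReal.ofReal (f y) ∂(κ x) ∂γ
      = ∫⁻ p, ENNReal.ofReal (f p.2) * s.indicator 1 p.1 ∂(γ ⊗ₘ κ) := by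
    rw [Measure.lintegral_compProd (by fun_prop), ← lintegral_indicator hs]
    refine lintegral_congr fun x => ?_
    dsimp only [Pi.mul_apply]
    rw [lintegral_mul_const _ hfm]
    by_cases hx : x ∈ s <;> simp [hx]
  rw [hA, hB, ← map_swap_compProd hrev, lintegral_map (by fun_prop) measurable_swap,
    map_swap_compProd hrev]
  rfl

end Chain

/-! ### Warm starts, total variation and decay of the chi-square distance. -/

section Decay

variable {α : Type*} [MeasurableSpace α] {γ : Measure α} [IsProbabilityMeasure γ]
  {κ : Kernel α α} [IsMarkovKernel κ]

theorem sq_integral_le_integral_sq {μ : Measure α} [IsProbabilityMeasure μ] {f : α → ℝ}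
    (hf : Integrable f μ) (hf2 : Integrable (fun x => f x ^ 2) μ) :
    (∫ x, f x ∂μ) ^ 2 ≤ ∫ x, f x ^ 2 ∂μ := by
  set a := ∫ x, f x ∂μ with ha
  have h : 0 ≤ ∫ x, (f x - a) ^ 2 ∂μ := integral_nonneg fun _ => sq_nonneg _
  have hexp : (fun x => (f x - a) ^ 2) = fun x => f x ^ 2 - (2 * a * f x - a ^ 2) := by
    funext x; ring
  rw [hexp, integral_sub hf2 (by exact (hf.const_mul _).sub (integrable_const _)),
    integral_sub (hf.const_mul _) (integrable_const _), integral_const_mul, integral_const,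
    probReal_univ, one_smul, ← ha] at h
  nlinarith

theorem IsWarm.exists_density {M : ℝ} {μ₀ : Measure α} [IsProbabilityMeasure μ₀]
    (h : IsWarm M μ₀ γ) :
    ∃ f : α → ℝ, Measurable f ∧ (∀ x, f x ∈ Set.Icc 0 M) ∧
      μ₀ = γ.withDensity fun x => ENNReal.ofReal (f x) := by
  have hM : 0 ≤ M := by
    by_contra hM
    have := h Set.univ MeasurableSet.univ
    rw [ENNReal.ofReal_of_nonpos (not_le.1 hM).le] at this
    simp at this
  have hac : μ₀ ≪ γ := by
    refine Measure.AbsolutelyContinuous.mk fun s hs h0 => ?_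
    have := h s hs
    rw [h0, mul_zero] at this
    exact le_antisymm this bot_le
  have hr : μ₀.rnDeriv γ ≤ᵐ[γ] fun _ => ENNReal.ofReal M := by
    refine ae_le_of_forall_setLIntegral_le_of_sigmaFinite (Measure.measurable_rnDeriv _ _)
      fun s hs _ => ?_
    rw [Measure.setLIntegral_rnDeriv hac, setLIntegral_const]
    exact h s hs
  -- The derivative is at most `M` only almost everywhere; truncating at `M` makes the bound hold at
  -- every point without changing the measure.
  refine ⟨fun x => min (μ₀.rnDeriv γ x).toReal M,
    (Measure.measurable_rnDeriv _ _).ennreal_toReal.min measurable_const,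
    fun x => ⟨le_min ENNReal.toReal_nonneg hM, min_le_right _ _⟩, ?_⟩
  rw [← Measure.withDensity_rnDeriv_eq μ₀ γ hac]
  refine withDensity_congr_ae ?_
  rw [Measure.withDensity_rnDeriv_eq μ₀ γ hac]
  filter_upwards [hr] with x hx
  have hx' : (μ₀.rnDeriv γ x).toReal ≤ M := ENNReal.toReal_le_of_le_ofReal hM hx
  rw [min_eq_left hx', ENNReal.ofReal_toReal (ne_top_of_le_ne_top ENNReal.ofReal_ne_top hx)]

theorem IsWarm.one_le {M : ℝ} {μ₀ : Measure α} [IsProbabilityMeasure μ₀]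
    (h : IsWarm M μ₀ γ) : 1 ≤ M := by
  have := h Set.univ MeasurableSet.univ
  rw [measure_univ, measure_univ, mul_one] at this
  exact ENNReal.one_le_ofReal.1 this

theorem abs_le_of_mem_Icc {f : α → ℝ} {M : ℝ} (h : ∀ x, f x ∈ Set.Icc 0 M) (x : α) :
    |f x| ≤ M :=
  abs_le.2 ⟨by linarith [(h x).1, (h x).2], (h x).2⟩

theorem integral_eq_one_of_density {f : α → ℝ} {M : ℝ} (hf : Measurable f)
    (h : ∀ x, f x ∈ Set.Icc 0 M)
    (hp : IsProbabilityMeasure (γ.withDensity fun x => ENNReal.ofReal (f x))) :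
    ∫ x, f x ∂γ = 1 := by
  have h1 := hp.measure_univ
  rw [withDensity_apply _ MeasurableSet.univ, Measure.restrict_univ,
    ← ofReal_integral_eq_lintegral_ofReal (integrable_of_abs_le hf (abs_le_of_mem_Icc h))
      (ae_of_all _ fun x => (h x).1)] at h1
  exact ENNReal.ofReal_eq_one.1 h1

/-- The difference of the measures of a set is at most the `L¹` norm of `f - 1`, hence at most its
`L²` norm, whose square is `∫ f² - 1`. -/
theorem tvDist_withDensity_le {f : α → ℝ} {M : ℝ} (hf : Measurable f)
    (h : ∀ x, f x ∈ Set.Icc 0 M) (h1 : ∫ x, f x ∂γ = 1) :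
    tvDist (γ.withDensity fun x => ENNReal.ofReal (f x)) γ
      ≤ Real.sqrt (∫ x, f x ^ 2 ∂γ - 1) := by
  have hfM := abs_le_of_mem_Icc h
  have hi : Integrable f γ := integrable_of_abs_le hf hfM
  have hi2 : Integrable (fun x => f x ^ 2) γ :=
    integrable_of_abs_le (hf.pow_const 2) (M := M ^ 2) fun x => by
      rw [abs_pow]; exact pow_le_pow_left₀ (abs_nonneg _) (hfM x) 2
  have hexp : (fun x => |f x - 1| ^ 2) = fun x => f x ^ 2 - (2 * f x - 1) := by
    funext x; rw [sq_abs]; ring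
  have hia : Integrable (fun x => |f x - 1|) γ := (hi.sub (integrable_const 1)).abs
  have hia2 : Integrable (fun x => |f x - 1| ^ 2) γ := by
    rw [hexp]; exact hi2.sub ((hi.const_mul 2).sub (integrable_const 1))
  have hval : ∫ x, |f x - 1| ^ 2 ∂γ = ∫ x, f x ^ 2 ∂γ - 1 := by
    rw [hexp, integral_sub hi2 (by exact (hi.const_mul 2).sub (integrable_const 1)),
      integral_sub (hi.const_mul 2) (integrable_const 1), integral_const_mul, h1]
    simp
    norm_num
  have hL1 : ∫ x, |f x - 1| ∂γ ≤ Real.sqrt (∫ x, f x ^ 2 ∂γ - 1) := by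
    rw [← hval]
    exact Real.le_sqrt_of_sq_le (sq_integral_le_integral_sq hia hia2)
  refine Real.iSup_le (fun ⟨s, hs⟩ => ?_) (Real.sqrt_nonneg _)
  refine le_trans ?_ hL1
  have e1 : (γ.withDensity fun x => ENNReal.ofReal (f x)).real s = ∫ x in s, f x ∂γ := by
    rw [Measure.real, withDensity_apply _ hs, integral_eq_lintegral_of_nonneg_ae
      (ae_of_all _ fun x => (h x).1) hf.aestronglyMeasurable]
  have e2 : γ.real s = ∫ x in s, (1 : ℝ) ∂γ := by simp
  rw [e1, e2, ← integral_sub hi.integrableOn (integrable_const 1).integrableOn]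
  exact (abs_integral_le_integral_abs).trans
    (setIntegral_le_integral hia (ae_of_all _ fun _ => abs_nonneg _))

theorem law_withDensity (hrev : κ.IsReversible γ) {f : α → ℝ} {M : ℝ} (hf : Measurable f)
    (h : ∀ x, f x ∈ Set.Icc 0 M) (n : ℕ) :
    Measurable ((kernelMap κ)^[n] f) ∧ (∀ x, (kernelMap κ)^[n] f x ∈ Set.Icc 0 M) ∧
    law κ (γ.withDensity fun x => ENNReal.ofReal (f x)) n
      = γ.withDensity fun x => ENNReal.ofReal ((kernelMap κ)^[n] f x) := by
  induction n with
  | zero => exact ⟨hf, h, rfl⟩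
  | succ n ih =>
    obtain ⟨hm, hb, hl⟩ := ih
    simp only [Function.iterate_succ_apply']
    refine ⟨measurable_kernelMap hm, kernelMap_mem_Icc hm hb, ?_⟩
    rw [law, hl, withDensity_bind hrev hm (fun x => (hb x).1) (fun x => (hb x).2)]

/-- A positive semidefinite reversible chain with an approximate Poincaré inequality on functions
with values in `[0, M]` contracts warm starts up to the defect of that inequality. -/
theorem tvDist_law_le (hrev : κ.IsReversible γ)
    (hpos : ∀ F : α → ℝ, Measurable F → (∃ M, ∀ x, |F x| ≤ M) →
      0 ≤ ∫ x, F x * kernelMap κ F x ∂γ)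
    {M ρ δ : ℝ} (hρ1 : ρ ≤ 1) (hδ : 0 ≤ δ)
    (hP : ∀ f : α → ℝ, Measurable f → (∀ x, f x ∈ Set.Icc 0 M) →
      ρ * (∫ x, f x ^ 2 ∂γ - (∫ x, f x ∂γ) ^ 2) ≤ dirichletForm γ κ f + ρ * (δ * M ^ 2))
    {μ₀ : Measure α} [hμ : IsProbabilityMeasure μ₀] (hw : IsWarm M μ₀ γ) (n : ℕ) :
    tvDist (law κ μ₀ n) γ ≤ Real.sqrt ((1 - ρ) ^ n * M ^ 2 + δ * M ^ 2) := by
  obtain ⟨f, hf, hfM, rfl⟩ := hw.exists_density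
  have h1 : ∫ x, f x ∂γ = 1 := integral_eq_one_of_density hf hfM hμ
  have hint : ∀ n, ∫ x, (kernelMap κ)^[n] f x ∂γ = 1 := by
    intro n
    induction n with
    | zero => exact h1
    | succ n ih =>
      obtain ⟨hm, hb, -⟩ := law_withDensity hrev hf hfM n
      simp only [Function.iterate_succ_apply']
      rw [integral_kernelMap hrev hm (abs_le_of_mem_Icc hb), ih]
  have hV : ∀ n, ∫ x, (kernelMap κ)^[n] f x ^ 2 ∂γ - 1 ≤ (1 - ρ) ^ n * M ^ 2 + δ * M ^ 2 := by
    intro n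
    induction n with
    | zero =>
      have hb : ∫ x, f x ^ 2 ∂γ ≤ ∫ _, M ^ 2 ∂γ := by
        refine integral_mono (integrable_of_abs_le (hf.pow_const 2) (M := M ^ 2) fun x => ?_)
          (integrable_const _) fun x => pow_le_pow_left₀ (hfM x).1 (hfM x).2 2
        rw [abs_pow]; exact pow_le_pow_left₀ (abs_nonneg _) (abs_le_of_mem_Icc hfM x) 2
      rw [integral_const, probReal_univ, one_smul] at hb
      have : 0 ≤ δ * M ^ 2 := by positivity
      simp only [Function.iterate_zero, id, pow_zero, one_mul]
      linarith
    | succ n ih =>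
      obtain ⟨hm, hb, -⟩ := law_withDensity hrev hf hfM n
      have hab := abs_le_of_mem_Icc hb
      -- With `v` the current variance, `a1` and `a2` say that the next one is at most `v` minus the
      -- Dirichlet form, and `a3` bounds this by `(1 - ρ) v + ρ δ M²`. The term `δ M²` is a fixed
      -- point of this recursion.
      have a1 := integral_kernelMap_sq_le hrev hpos hm hab
      have a2 := dirichletForm_eq hrev hm hab
      have a3 := hP _ hm hb
      rw [hint n] at a3
      simp only [Function.iterate_succ_apply']
      have a4 := mul_le_mul_of_nonneg_left ih (sub_nonneg.2 hρ1)
      rw [pow_succ]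
      linarith
  obtain ⟨hm, hb, hl⟩ := law_withDensity hrev hf hfM n
  rw [hl]
  exact (tvDist_withDensity_le hm hb (hint n)).trans (Real.sqrt_le_sqrt (hV n))

/-- Warmness gives `γ(s) ≥ μ₀(s) / M`, so `μ₀(s) - γ(s) ≤ (1 - 1/M) μ₀(s)`; complements give the
other sign. This settles the case of large `ε` with no step of the chain. -/
theorem tvDist_le_of_isWarm {M : ℝ} {μ₀ : Measure α} [IsProbabilityMeasure μ₀]
    (hw : IsWarm M μ₀ γ) : tvDist μ₀ γ ≤ 1 - 1 / M := by
  have hM := hw.one_le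
  have hM0 : 0 < M := by linarith
  have key : ∀ s, MeasurableSet s → μ₀.real s - γ.real s ≤ 1 - 1 / M := by
    intro s hs
    have h1 : μ₀.real s ≤ M * γ.real s := by
      have := ENNReal.toReal_mono (by finiteness) (hw s hs)
      rwa [ENNReal.toReal_mul, ENNReal.toReal_ofReal hM0.le] at this
    have h2 : μ₀.real s ≤ 1 := measureReal_le_one
    have h3 : μ₀.real s / M ≤ γ.real s := by rw [div_le_iff₀ hM0]; linarith
    have h4 : 0 ≤ 1 - 1 / M := by rw [sub_nonneg, div_le_one hM0]; exact hM
    have h5 : μ₀.real s * (1 - 1 / M) ≤ 1 * (1 - 1 / M) := mul_le_mul_of_nonneg_right h2 h4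
    have h6 : μ₀.real s * (1 - 1 / M) = μ₀.real s - μ₀.real s / M := by ring
    linarith
  refine Real.iSup_le (fun ⟨s, hs⟩ => abs_le.2 ⟨?_, key s hs⟩) ?_
  · have := key sᶜ hs.compl
    rw [probReal_compl_eq_one_sub hs, probReal_compl_eq_one_sub hs] at this
    linarith
  · rw [sub_nonneg, div_le_one hM0]; exact hM

theorem exists_mixingTime_eq {T : Kernel α α} {π μ₀ : Measure α} {ε : ℝ} {N : ℕ}
    (h : tvDist (law T μ₀ N) π ≤ ε) : ∃ n : ℕ, mixingTime T π μ₀ ε = n ∧ n ≤ N := by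
  have hle : mixingTime T π μ₀ ε ≤ N := iInf₂_le N h
  obtain ⟨n, hn⟩ := ENat.ne_top_iff_exists.1 (ne_top_of_le_ne_top (ENat.natCast_ne_top N) hle)
  refine ⟨n, hn.symm, ?_⟩
  rw [← hn] at hle
  exact_mod_cast hle

end Decay

/-! ### The Gaussian Poincaré inequality by rotation of two independent copies. -/

section Poincare

variable {E : Type*} [NormedAddCommGroup E] [InnerProductSpace ℝ E] [FiniteDimensional ℝ E]
  [MeasurableSpace E] [BorelSpace E]

/-- The characteristic function of the product at the functional given by `(a, b)` depends on `‖a‖²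
+ ‖b‖²` only, which the transposed rotation preserves. -/
theorem map_rotation_stdGaussian (θ : ℝ) :
    ((stdGaussian E).prod (stdGaussian E)).map (ContinuousLinearMap.rotation θ)
      = (stdGaussian E).prod (stdGaussian E) := by
  have : IsProbabilityMeasure (((stdGaussian E).prod (stdGaussian E)).map
      (ContinuousLinearMap.rotation θ : E × E →L[ℝ] E × E)) :=
    Measure.isProbabilityMeasure_map (ContinuousLinearMap.continuous _).measurable.aemeasurable
  apply Measure.ext_of_charFunDual
  ext L
  rw [charFunDual_map, charFunDual_prod, charFunDual_prod]
  simp only [charFunDual_stdGaussian]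
  rw [← Complex.exp_add, ← Complex.exp_add]
  congr 1
  obtain ⟨a, ha⟩ := (InnerProductSpace.toDual ℝ E).surjective
    (L.comp (ContinuousLinearMap.inl ℝ E E))
  obtain ⟨b, hb⟩ := (InnerProductSpace.toDual ℝ E).surjective
    (L.comp (ContinuousLinearMap.inr ℝ E E))
  have hL : ∀ x y : E, L (x, y) = inner ℝ a x + inner ℝ b y := by
    intro x y
    have h1 : L (x, 0) = inner ℝ a x := by
      have := congrArg (fun T => T x) ha
      simpa using this.symm
    have h2 : L (0, y) = inner ℝ b y := by
      have := congrArg (fun T => T y) hb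
      simpa using this.symm
    rw [← h1, ← h2, ← map_add]
    simp
  have hc : (L.comp (ContinuousLinearMap.rotation θ)).comp (ContinuousLinearMap.inl ℝ E E)
      = InnerProductSpace.toDual ℝ E (Real.cos θ • a - Real.sin θ • b) := by
    ext x
    simp [ContinuousLinearMap.rotation_apply, hL, inner_smul_right, inner_neg_right]
    ring
  have hd : (L.comp (ContinuousLinearMap.rotation θ)).comp (ContinuousLinearMap.inr ℝ E E)
      = InnerProductSpace.toDual ℝ E (Real.sin θ • a + Real.cos θ • b) := by
    ext x
    simp [ContinuousLinearMap.rotation_apply, hL, inner_smul_right]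
  rw [hc, hd, ← ha, ← hb]
  simp only [LinearIsometryEquiv.norm_map]
  have key : ‖Real.cos θ • a - Real.sin θ • b‖ ^ 2 + ‖Real.sin θ • a + Real.cos θ • b‖ ^ 2
      = ‖a‖ ^ 2 + ‖b‖ ^ 2 := by
    rw [norm_sub_sq_real, norm_add_sq_real]
    simp only [norm_smul, inner_smul_left, inner_smul_right, mul_pow, Real.norm_eq_abs, sq_abs]
    simp only [conj_trivial]
    linear_combination (‖a‖ ^ 2 + ‖b‖ ^ 2) * Real.sin_sq_add_cos_sq θ
  have key' : ((‖Real.cos θ • a - Real.sin θ • b‖ : ℂ) ^ 2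
      + (‖Real.sin θ • a + Real.cos θ • b‖ : ℂ) ^ 2) = (‖a‖ : ℂ) ^ 2 + (‖b‖ : ℂ) ^ 2 := by
    exact_mod_cast key
  linear_combination (-1 / 2 : ℂ) * key'

theorem integral_dual_sq_stdGaussian (L : StrongDual ℝ E) :
    ∫ z, (L z) ^ 2 ∂(stdGaussian E) = ‖L‖ ^ 2 := by
  rw [← variance_dual_stdGaussian L, variance_of_integral_eq_zero L.continuous.aemeasurable
    (integral_strongDual_stdGaussian L)]

theorem sq_integral_le_measure_mul {α : Type*} [MeasurableSpace α] {μ : Measure α}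
    [IsFiniteMeasure μ] {f : α → ℝ} (hf : Integrable f μ) (hf2 : Integrable (fun x => f x ^ 2) μ) :
    (∫ x, f x ∂μ) ^ 2 ≤ μ.real Set.univ * ∫ x, f x ^ 2 ∂μ := by
  set a := ∫ x, f x ∂μ with ha
  set m := μ.real Set.univ with hm
  have h : 0 ≤ ∫ x, (m * f x - a) ^ 2 ∂μ := integral_nonneg fun _ => sq_nonneg _
  have hexp : (fun x => (m * f x - a) ^ 2)
      = fun x => m ^ 2 * f x ^ 2 - (2 * m * a * f x - a ^ 2) := by
    funext x; ring
  rw [hexp, integral_sub (hf2.const_mul _)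
    (by exact (hf.const_mul _).sub (integrable_const _)),
    integral_sub (hf.const_mul _) (integrable_const _), integral_const_mul, integral_const_mul,
    integral_const, smul_eq_mul, ← ha, ← hm] at h
  -- The expansion yields the inequality multiplied by `m`; the zero measure has to be treated apart
  -- before dividing.
  have hm0 : 0 ≤ m := measureReal_nonneg
  rcases hm0.eq_or_lt with h0 | h0
  · have hμ : μ = 0 := by
      have : μ.real Set.univ = 0 := by rw [← hm, ← h0]
      rwa [measureReal_eq_zero_iff, Measure.measure_univ_eq_zero] at this
    have : a = 0 := by rw [ha, hμ]; simp
    rw [this, ← h0]; simp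
  · have : 0 ≤ m * (m * ∫ x, f x ^ 2 ∂μ - a ^ 2) := by
      calc (0 : ℝ) ≤ _ := h
        _ = _ := by ring
    have := nonneg_of_mul_nonneg_right this h0
    linarith

theorem hasDerivAt_comp_rotation {g : E → ℝ} (hd : Differentiable ℝ g) (p : E × E) (θ : ℝ) :
    HasDerivAt (fun θ => g (ContinuousLinearMap.rotation θ p).1)
      (fderiv ℝ g (ContinuousLinearMap.rotation θ p).1 (ContinuousLinearMap.rotation θ p).2) θ := by
  have h1 : HasDerivAt (fun θ : ℝ => (ContinuousLinearMap.rotation θ p).1)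
      (ContinuousLinearMap.rotation θ p).2 θ := by
    simp only [ContinuousLinearMap.rotation_apply]
    exact ((Real.hasDerivAt_cos θ).smul_const p.1).add ((Real.hasDerivAt_sin θ).smul_const p.2)
  exact (hd (ContinuousLinearMap.rotation θ p).1).hasFDerivAt.comp_hasDerivAt θ h1

theorem norm_snd_rotation_le (p : E × E) (θ : ℝ) :
    ‖(ContinuousLinearMap.rotation θ p).2‖ ≤ ‖p.1‖ + ‖p.2‖ := by
  simp only [ContinuousLinearMap.rotation_apply]
  refine (norm_add_le _ _).trans (add_le_add ?_ ?_)
  · rw [norm_smul, norm_neg]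
    exact mul_le_of_le_one_left (norm_nonneg _) (Real.abs_sin_le_one θ)
  · rw [norm_smul]
    exact mul_le_of_le_one_left (norm_nonneg _) (Real.abs_cos_le_one θ)

/-- The Gaussian Poincaré inequality, with a constant that the rotation interpolation gives. -/
theorem variance_le_integral_fderiv_sq {g : E → ℝ} (hd : Differentiable ℝ g) {B : ℝ}
    (hB : ∀ x, ‖fderiv ℝ g x‖ ≤ B) {M : ℝ} (hM : ∀ x, |g x| ≤ M) :
    ∫ x, g x ^ 2 ∂(stdGaussian E) - (∫ x, g x ∂(stdGaussian E)) ^ 2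
      ≤ Real.pi ^ 2 / 8 * ∫ x, ‖fderiv ℝ g x‖ ^ 2 ∂(stdGaussian E) := by
  set γ := stdGaussian E with hγ
  have hgm : Measurable g := hd.continuous.measurable
  have hB0 : 0 ≤ B := (norm_nonneg _).trans (hB 0)
  obtain ⟨D, hD⟩ : ∃ D : E × E → ℝ, D = fun p => fderiv ℝ g p.1 p.2 := ⟨_, rfl⟩
  have hDm : Measurable D := by
    rw [hD]
    have h1 : Measurable fun p : E × E => (fderiv ℝ g p.1, p.2) :=
      ((measurable_fderiv ℝ g).comp measurable_fst).prodMk measurable_snd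
    exact (isBoundedBilinearMap_apply (𝕜 := ℝ) (E := E) (F := ℝ)).continuous.measurable.comp h1
  have hDle : ∀ p, |D p| ≤ B * ‖p.2‖ := fun p => by
    rw [hD]
    exact ((fderiv ℝ g p.1).le_opNorm p.2).trans (mul_le_mul_of_nonneg_right (hB _) (norm_nonneg _))
  obtain ⟨R, hR⟩ : ∃ R : ℝ → E × E → E × E, R = fun θ p => ContinuousLinearMap.rotation θ p :=
    ⟨_, rfl⟩
  have hRm : Measurable fun q : ℝ × (E × E) => R q.1 q.2 := by
    have : Continuous fun q : ℝ × (E × E) => R q.1 q.2 := by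
      simp only [hR, ContinuousLinearMap.rotation_apply]
      fun_prop
    exact this.measurable
  have hderiv : ∀ (p : E × E) (θ : ℝ), HasDerivAt (fun θ => g (R θ p).1) (D (R θ p)) θ := by
    rw [hR, hD]
    exact hasDerivAt_comp_rotation hd
  have hRle : ∀ (p : E × E) (θ : ℝ), ‖(R θ p).2‖ ≤ ‖p.1‖ + ‖p.2‖ := by
    rw [hR]
    exact norm_snd_rotation_le
  have hDR : ∀ (p : E × E) (θ : ℝ), |D (R θ p)| ≤ B * (‖p.1‖ + ‖p.2‖) := fun p θ =>
    (hDle _).trans (mul_le_mul_of_nonneg_left (hRle p θ) hB0)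
  have hDRsq : ∀ (p : E × E) (θ : ℝ), |D (R θ p) ^ 2| ≤ 2 * B ^ 2 * (‖p.1‖ ^ 2 + ‖p.2‖ ^ 2) := by
    intro p θ
    rw [abs_pow]
    refine (pow_le_pow_left₀ (abs_nonneg _) (hDR p θ) 2).trans ?_
    nlinarith [mul_nonneg (sq_nonneg B) (sq_nonneg (‖p.1‖ - ‖p.2‖))]
  set ν : Measure ℝ := volume.restrict (Set.Ioc 0 (Real.pi / 2)) with hν
  have hνu : ν.real Set.univ = Real.pi / 2 := by
    rw [hν, measureReal_restrict_apply_univ, Real.volume_real_Ioc_of_le (by positivity)]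
    ring
  have hsec : ∀ p : E × E, Measurable fun θ => D (R θ p) := by
    intro p
    have h1 : Measurable fun θ : ℝ => (θ, p) := measurable_id.prodMk measurable_const
    have h2 : Measurable fun θ : ℝ => R θ p := hRm.comp h1
    exact hDm.comp h2
  -- The quarter turn carries the first coordinate from `p.1` to `p.2`. The difference of values is
  -- the integral of the derivative along it, and Cauchy–Schwarz on an interval of length `π/2`
  -- gives the factor.
  have hpt : ∀ p : E × E, (g p.2 - g p.1) ^ 2 ≤ Real.pi / 2 * ∫ θ, D (R θ p) ^ 2 ∂ν := by
    intro p
    have hi : Integrable (fun θ => D (R θ p)) ν := integrable_of_abs_le (hsec p) (hDR p)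
    have hi2 : Integrable (fun θ => D (R θ p) ^ 2) ν :=
      integrable_of_abs_le ((hsec p).pow_const 2) (hDRsq p)
    have hftc := intervalIntegral.integral_eq_sub_of_hasDerivAt (a := 0) (b := Real.pi / 2)
      (fun θ _ => hderiv p θ)
      ((intervalIntegrable_iff_integrableOn_Ioc_of_le (by positivity)).2 hi)
    rw [intervalIntegral.integral_of_le (by positivity)] at hftc
    have hR0 : (R 0 p).1 = p.1 := by simp [hR, ContinuousLinearMap.rotation_apply]
    have hR1 : (R (Real.pi / 2) p).1 = p.2 := by simp [hR, ContinuousLinearMap.rotation_apply]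
    rw [hR0, hR1] at hftc
    have := sq_integral_le_measure_mul hi hi2
    rw [hνu] at this
    rw [← hftc]
    exact this
  have hn2 : Integrable (fun x : E => ‖x‖ ^ 2) γ :=
    (IsGaussian.memLp_id γ 2 (by simp)).integrable_norm_pow (by norm_num)
  have hnn : Integrable (fun p : E × E => 2 * B ^ 2 * (‖p.1‖ ^ 2 + ‖p.2‖ ^ 2)) (γ.prod γ) :=
    ((hn2.comp_fst γ).add (hn2.comp_snd γ)).const_mul _
  have hint : Integrable (fun q : (E × E) × ℝ => D (R q.2 q.1) ^ 2) ((γ.prod γ).prod ν) := by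
    refine Integrable.mono' (hnn.comp_fst ν) ?_ (ae_of_all _ fun q => ?_)
    · exact ((hDm.comp (hRm.comp measurable_swap)).pow_const 2).aestronglyMeasurable
    · rw [Real.norm_eq_abs]; exact hDRsq _ _
  have hDi : ∫ p, D p ^ 2 ∂(γ.prod γ) = ∫ x, ‖fderiv ℝ g x‖ ^ 2 ∂γ := by
    rw [integral_prod]
    · simp only [hD, integral_dual_sq_stdGaussian, hγ]
    · refine Integrable.mono' hnn (hDm.pow_const 2).aestronglyMeasurable (ae_of_all _ fun p => ?_)
      rw [Real.norm_eq_abs]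
      simpa [hR, ContinuousLinearMap.rotation_apply] using hDRsq p 0
  -- By rotation invariance the angle drops out, so twice the variance is at most `(π/2) · (π/2)`
  -- times the energy; this is the constant `π²/8`.
  have hrot : ∀ θ, ∫ p, D (R θ p) ^ 2 ∂(γ.prod γ) = ∫ x, ‖fderiv ℝ g x‖ ^ 2 ∂γ := by
    intro θ
    rw [← hDi]
    conv_rhs => rw [hγ, ← map_rotation_stdGaussian θ]
    rw [hR, integral_map (ContinuousLinearMap.continuous _).measurable.aemeasurable
      (hDm.pow_const 2).aestronglyMeasurable]
  have hgi : Integrable g γ := integrable_of_abs_le hgm hM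
  have hgi2 : Integrable (fun x => g x ^ 2) γ :=
    integrable_of_abs_le (hgm.pow_const 2) (M := M ^ 2) fun x => by
      rw [abs_pow]; exact pow_le_pow_left₀ (abs_nonneg _) (hM x) 2
  have hexp : (fun p : E × E => (g p.2 - g p.1) ^ 2)
      = fun p => (g p.1 ^ 2 + g p.2 ^ 2) - 2 * (g p.1 * g p.2) := by
    funext p; ring
  have i1 : Integrable (fun p : E × E => g p.1 ^ 2) (γ.prod γ) := hgi2.comp_fst γ
  have i2 : Integrable (fun p : E × E => g p.2 ^ 2) (γ.prod γ) := hgi2.comp_snd γ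
  have i3 : Integrable (fun p : E × E => g p.1 * g p.2) (γ.prod γ) := hgi.mul_prod hgi
  have hvar : ∫ p, (g p.2 - g p.1) ^ 2 ∂(γ.prod γ)
      = 2 * (∫ x, g x ^ 2 ∂γ - (∫ x, g x ∂γ) ^ 2) := by
    rw [hexp, integral_sub (by exact i1.add i2) (i3.const_mul 2), integral_add i1 i2,
      integral_const_mul, integral_prod_mul, integral_fun_fst (fun x => g x ^ 2),
      integral_fun_snd (fun x => g x ^ 2)]
    simp
    ring
  have hle : ∫ p, (g p.2 - g p.1) ^ 2 ∂(γ.prod γ)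
      ≤ ∫ p, Real.pi / 2 * ∫ θ, D (R θ p) ^ 2 ∂ν ∂(γ.prod γ) := by
    refine integral_mono ?_ (hint.integral_prod_left.const_mul _) hpt
    rw [hexp]
    exact (i1.add i2).sub (i3.const_mul 2)
  rw [hvar, integral_const_mul, integral_integral_swap hint] at hle
  simp_rw [hrot] at hle
  rw [integral_const, hνu, smul_eq_mul] at hle
  linarith

end Poincare

/-! ### The density of accepted moves: symmetry and positive semidefiniteness. -/

section AcceptedDensity

variable {E : Type*} [NormedAddCommGroup E] [InnerProductSpace ℝ E] [FiniteDimensional ℝ E]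
  [MeasurableSpace E] [BorelSpace E]

/-- The density of the accepted moves of MALA for the standard Gaussian target. -/
def acceptedDensity (h : ℝ) (x y : E) : ℝ :=
  gaussianDensity (2 * h) (y - (1 - h) • x) * min 1 (Real.exp (-(h / 4) * (‖y‖ ^ 2 - ‖x‖ ^ 2)))

theorem continuous_acceptedDensity (h : ℝ) :
    Continuous fun p : E × E => acceptedDensity h p.1 p.2 := by
  unfold acceptedDensity gaussianDensity
  fun_prop

theorem acceptedDensity_nonneg {h : ℝ} (hh : 0 < h) (x y : E) : 0 ≤ acceptedDensity h x y :=
  mul_nonneg (gaussianDensity_pos (by positivity) _).le (le_min zero_le_one (Real.exp_pos _).le)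

theorem acceptedDensity_le {h : ℝ} (hh : 0 < h) (x y : E) :
    acceptedDensity h x y ≤ gaussianDensity (2 * h) (y - (1 - h) • x) :=
  mul_le_of_le_one_right (gaussianDensity_pos (by positivity) _).le (min_le_left _ _)

theorem integrable_acceptedDensity {h : ℝ} (hh : 0 < h) (x : E) :
    Integrable (acceptedDensity h x) := by
  refine Integrable.mono' ((integrable_gaussianDensity (s := 2 * h)
    (by positivity)).comp_sub_right ((1 - h) • x)) ?_ (ae_of_all _ fun y => ?_)
  · exact ((continuous_acceptedDensity h).comp
      (continuous_const.prodMk continuous_id)).aestronglyMeasurable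
  · rw [Real.norm_eq_abs, abs_of_nonneg (acceptedDensity_nonneg hh x y)]
    exact acceptedDensity_le hh x y

theorem integral_acceptedDensity_le_one {h : ℝ} (hh : 0 < h) (x : E) :
    ∫ y, acceptedDensity h x y ≤ 1 := by
  have h2 : (0 : ℝ) < 2 * h := by positivity
  calc ∫ y, acceptedDensity h x y ≤ ∫ y, gaussianDensity (2 * h) (y - (1 - h) • x) :=
        integral_mono (integrable_acceptedDensity hh x)
          ((integrable_gaussianDensity h2).comp_sub_right _) (acceptedDensity_le hh x)
    _ = 1 := by
        rw [integral_sub_right_eq_self (gaussianDensity (2 * h)), integral_gaussianDensity h2]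

/-- The joint density of an accepted move in stationarity, in a form that shows its symmetry. -/
theorem gaussianDensity_mul_acceptedDensity {h : ℝ} (hh : 0 < h) (x y : E) :
    gaussianDensity 1 x * acceptedDensity h x y
      = ((2 * Real.pi) ^ ((Module.finrank ℝ E : ℝ) / 2))⁻¹ *
        ((2 * Real.pi * (2 * h)) ^ ((Module.finrank ℝ E : ℝ) / 2))⁻¹ *
        (Real.exp (-(‖x‖ ^ 2 + ‖y‖ ^ 2) / (4 * h) + (1 - h) / (2 * h) * inner ℝ x y) *
        min (Real.exp (-(h / 4) * ‖x‖ ^ 2)) (Real.exp (-(h / 4) * ‖y‖ ^ 2))) := by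
  unfold acceptedDensity gaussianDensity
  have h1 : min (Real.exp (-(h / 4) * ‖x‖ ^ 2)) (Real.exp (-(h / 4) * ‖y‖ ^ 2))
      = Real.exp (-(h / 4) * ‖x‖ ^ 2)
        * min 1 (Real.exp (-(h / 4) * (‖y‖ ^ 2 - ‖x‖ ^ 2))) := by
    rw [mul_min_of_nonneg _ _ (Real.exp_pos _).le, mul_one, ← Real.exp_add]
    congr 2
    ring
  have h2 : Real.exp (-‖x‖ ^ 2 / (2 * 1)) * Real.exp (-‖y - (1 - h) • x‖ ^ 2 / (2 * (2 * h)))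
      = Real.exp (-(‖x‖ ^ 2 + ‖y‖ ^ 2) / (4 * h) + (1 - h) / (2 * h) * inner ℝ x y)
        * Real.exp (-(h / 4) * ‖x‖ ^ 2) := by
    rw [← Real.exp_add, ← Real.exp_add, norm_sub_sq_real, norm_smul, inner_smul_right, mul_pow,
      Real.norm_eq_abs, sq_abs, real_inner_comm]
    congr 1
    field_simp
    ring
  simp only [mul_one] at h2 ⊢
  rw [h1, ← mul_assoc (Real.exp (-(‖x‖ ^ 2 + ‖y‖ ^ 2) / (4 * h) + _)), ← h2]
  ring

theorem gaussianDensity_mul_acceptedDensity_comm {h : ℝ} (hh : 0 < h) (x y : E) :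
    gaussianDensity 1 x * acceptedDensity h x y = gaussianDensity 1 y * acceptedDensity h y x := by
  rw [gaussianDensity_mul_acceptedDensity hh, gaussianDensity_mul_acceptedDensity hh,
    min_comm, add_comm (‖x‖ ^ 2), real_inner_comm]

theorem integrable_gaussianDensity_mul_acceptedDensity {h : ℝ} (hh : 0 < h) :
    Integrable (fun p : E × E => gaussianDensity 1 p.1 * acceptedDensity h p.1 p.2)
      ((volume : Measure E).prod volume) := by
  have hc : Continuous fun p : E × E => gaussianDensity 1 p.1 * acceptedDensity h p.1 p.2 :=
    ((continuous_gaussianDensity 1).comp continuous_fst).mul (continuous_acceptedDensity h)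
  rw [integrable_prod_iff hc.aestronglyMeasurable]
  refine ⟨ae_of_all _ fun x => (integrable_acceptedDensity hh x).const_mul (gaussianDensity 1 x), ?_⟩
  refine Integrable.mono' (integrable_gaussianDensity (E := E) one_pos) ?_
    (ae_of_all _ fun x => ?_)
  · exact hc.norm.aestronglyMeasurable.integral_prod_right'
  · have h1 : ∀ y, ‖gaussianDensity 1 x * acceptedDensity h x y‖
        = gaussianDensity 1 x * acceptedDensity h x y := fun y => by
      rw [Real.norm_eq_abs, abs_of_nonneg
        (mul_nonneg (gaussianDensity_pos one_pos x).le (acceptedDensity_nonneg hh x y))]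
    simp only [h1]
    rw [integral_const_mul, Real.norm_eq_abs, abs_of_nonneg (mul_nonneg
      (gaussianDensity_pos one_pos x).le (integral_nonneg fun y => acceptedDensity_nonneg hh x y))]
    exact mul_le_of_le_one_right (gaussianDensity_pos one_pos x).le
      (integral_acceptedDensity_le_one hh x)

/-- After exchanging the integrals, each `ω` contributes the square of `∫ F u_ω`. -/
theorem integral_mixture_nonneg {α Ω : Type*} [MeasurableSpace α] [MeasurableSpace Ω]
    {μ : Measure α} {m : Measure Ω} [SFinite μ] [SFinite m] {u : Ω → α → ℝ}
    (hu : Integrable (fun q : (α × α) × Ω => u q.2 q.1.1 * u q.2 q.1.2) ((μ.prod μ).prod m))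
    {F : α → ℝ} (hF : Measurable F) {M : ℝ} (hM : ∀ x, |F x| ≤ M) :
    0 ≤ ∫ p : α × α, F p.1 * F p.2 * ∫ ω, u ω p.1 * u ω p.2 ∂m ∂(μ.prod μ) := by
  have hi : Integrable (fun q : (α × α) × Ω => F q.1.1 * F q.1.2 * (u q.2 q.1.1 * u q.2 q.1.2))
      ((μ.prod μ).prod m) := by
    refine hu.bdd_mul (c := M * M) (by fun_prop) (ae_of_all _ fun q => ?_)
    rw [Real.norm_eq_abs, abs_mul]
    exact mul_le_mul (hM _) (hM _) (abs_nonneg _) ((abs_nonneg _).trans (hM q.1.1))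
  simp_rw [← integral_const_mul]
  rw [integral_integral_swap hi]
  refine integral_nonneg fun ω => ?_
  have h1 : ∀ p : α × α, F p.1 * F p.2 * (u ω p.1 * u ω p.2)
      = (F p.1 * u ω p.1) * (F p.2 * u ω p.2) := fun p => by ring
  simp_rw [h1]
  rw [integral_prod_mul (fun x => F x * u ω x) (fun x => F x * u ω x)]
  exact mul_self_nonneg _

/-- The mixture components of the joint density of accepted moves. -/
def mixtureComponent (h : ℝ) (ω : E × ℝ) (x : E) : ℝ :=
  Real.exp (-(h / (1 - h)) / 2 * ‖ω.1‖ ^ 2 + inner ℝ x ω.1) *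
    (Real.exp (-((2 - h) / (4 * h)) * ‖x‖ ^ 2) *
      (Set.Iio (Real.exp (-(h / 4) * ‖x‖ ^ 2))).indicator 1 ω.2)

theorem measurable_mixtureComponent (h : ℝ) :
    Measurable fun q : (E × ℝ) × E => mixtureComponent h q.1 q.2 := by
  unfold mixtureComponent
  refine Measurable.mul (by fun_prop) (Measurable.mul (by fun_prop) ?_)
  have : (fun q : (E × ℝ) × E =>
      (Set.Iio (Real.exp (-(h / 4) * ‖q.2‖ ^ 2))).indicator (1 : ℝ → ℝ) q.1.2)
      = {q : (E × ℝ) × E | q.1.2 < Real.exp (-(h / 4) * ‖q.2‖ ^ 2)}.indicator 1 := by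
    funext q
    simp [Set.indicator_apply]
  rw [this]
  exact measurable_one.indicator (measurableSet_lt (by fun_prop) (by fun_prop))

theorem mixtureComponent_mul (h : ℝ) (ω : E × ℝ) (x y : E) :
    mixtureComponent h ω x * mixtureComponent h ω y
      = Real.exp (-((2 - h) / (4 * h)) * (‖x‖ ^ 2 + ‖y‖ ^ 2)) *
        (Real.exp (-(h / (1 - h)) * ‖ω.1‖ ^ 2 + inner ℝ (x + y) ω.1) *
          (Set.Iio (min (Real.exp (-(h / 4) * ‖x‖ ^ 2))
            (Real.exp (-(h / 4) * ‖y‖ ^ 2)))).indicator 1 ω.2) := by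
  have h1 : Real.exp (-((2 - h) / (4 * h)) * (‖x‖ ^ 2 + ‖y‖ ^ 2))
      = Real.exp (-((2 - h) / (4 * h)) * ‖x‖ ^ 2) * Real.exp (-((2 - h) / (4 * h)) * ‖y‖ ^ 2) := by
    rw [← Real.exp_add]; congr 1; ring
  have h2 : Real.exp (-(h / (1 - h)) * ‖ω.1‖ ^ 2 + inner ℝ (x + y) ω.1)
      = Real.exp (-(h / (1 - h)) / 2 * ‖ω.1‖ ^ 2 + inner ℝ x ω.1)
        * Real.exp (-(h / (1 - h)) / 2 * ‖ω.1‖ ^ 2 + inner ℝ y ω.1) := by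
    rw [← Real.exp_add, inner_add_left]; congr 1; ring
  have h3 : (Set.Iio (min (Real.exp (-(h / 4) * ‖x‖ ^ 2))
      (Real.exp (-(h / 4) * ‖y‖ ^ 2)))).indicator (1 : ℝ → ℝ) ω.2
      = (Set.Iio (Real.exp (-(h / 4) * ‖x‖ ^ 2))).indicator 1 ω.2
        * (Set.Iio (Real.exp (-(h / 4) * ‖y‖ ^ 2))).indicator 1 ω.2 := by
    rw [← Set.Iio_inter_Iio, Set.inter_indicator_one]
    rfl
  rw [h1, h2, h3]
  unfold mixtureComponent
  ring

theorem integrable_mixtureComponent_mul {h : ℝ} (hh : 0 < h) (h1 : h < 1) (x y : E) :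
    Integrable (fun ω => mixtureComponent h ω x * mixtureComponent h ω y)
      ((volume : Measure E).prod (volume.restrict (Set.Ioc (0 : ℝ) 1))) := by
  simp_rw [mixtureComponent_mul]
  refine Integrable.const_mul (Integrable.mul_prod
    (integrable_exp_neg_mul_sq_norm_add_inner (div_pos hh (sub_pos.2 h1)) (x + y)) ?_) _
  exact (integrable_const (1 : ℝ)).indicator measurableSet_Iio

/-- Two linearizations. The coupling `⟨x, y⟩` is completed to a positive multiple of `‖x + y‖²`,
whose exponential is a Gaussian Laplace transform in `z`; this needs `h < 1`. The minimum of two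
numbers in `(0, 1]` is the length of the set of `t > 0` lying below both. -/
theorem integral_mixtureComponent_mul {h : ℝ} (hh : 0 < h) (h1 : h < 1) (x y : E) :
    ∫ ω, mixtureComponent h ω x * mixtureComponent h ω y
        ∂((volume : Measure E).prod (volume.restrict (Set.Ioc (0 : ℝ) 1)))
      = (Real.pi / (h / (1 - h))) ^ ((Module.finrank ℝ E : ℝ) / 2) *
        (Real.exp (-(‖x‖ ^ 2 + ‖y‖ ^ 2) / (4 * h) + (1 - h) / (2 * h) * inner ℝ x y) *
        min (Real.exp (-(h / 4) * ‖x‖ ^ 2)) (Real.exp (-(h / 4) * ‖y‖ ^ 2))) := by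
  have h1' : 0 < 1 - h := sub_pos.2 h1
  simp_rw [mixtureComponent_mul]
  set a := min (Real.exp (-(h / 4) * ‖x‖ ^ 2)) (Real.exp (-(h / 4) * ‖y‖ ^ 2)) with ha
  have ha0 : 0 < a := lt_min (Real.exp_pos _) (Real.exp_pos _)
  have ha1 : a ≤ 1 := (min_le_left _ _).trans (Real.exp_le_one_iff.2 (by
    have : 0 ≤ h / 4 * ‖x‖ ^ 2 := by positivity
    linarith))
  have hind : ∫ t in Set.Ioc (0 : ℝ) 1, (Set.Iio a).indicator (1 : ℝ → ℝ) t = a := by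
    rw [integral_indicator_one measurableSet_Iio, measureReal_restrict_apply measurableSet_Iio]
    have : Set.Iio a ∩ Set.Ioc 0 1 = Set.Ioo 0 a := by
      ext t
      simp only [Set.mem_inter_iff, Set.mem_Iio, Set.mem_Ioc, Set.mem_Ioo]
      constructor
      · rintro ⟨h1, h2, -⟩; exact ⟨h2, h1⟩
      · rintro ⟨h1, h2⟩; exact ⟨h2, h1, by linarith⟩
    rw [this, Real.volume_real_Ioo_of_le ha0.le, sub_zero]
  rw [integral_const_mul, integral_prod_mul
    (fun z : E => Real.exp (-(h / (1 - h)) * ‖z‖ ^ 2 + inner ℝ (x + y) z))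
    (fun t : ℝ => (Set.Iio a).indicator 1 t), hind,
    integral_exp_neg_mul_sq_norm_add_inner (div_pos hh h1')]
  have hexp : Real.exp (-((2 - h) / (4 * h)) * (‖x‖ ^ 2 + ‖y‖ ^ 2))
        * Real.exp (‖x + y‖ ^ 2 / (4 * (h / (1 - h))))
      = Real.exp (-(‖x‖ ^ 2 + ‖y‖ ^ 2) / (4 * h) + (1 - h) / (2 * h) * inner ℝ x y) := by
    rw [← Real.exp_add, norm_add_sq_real]
    congr 1
    field_simp
    ring
  rw [← hexp]
  ring

theorem integral_acceptedDensity_bilinear_nonneg {h : ℝ} (hh : 0 < h) (h1 : h < 1) {F : E → ℝ}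
    (hF : Measurable F) {M : ℝ} (hM : ∀ x, |F x| ≤ M) :
    0 ≤ ∫ x, F x * (∫ y, acceptedDensity h x y * F y) ∂(stdGaussian E) := by
  have h1' : 0 < 1 - h := sub_pos.2 h1
  set C : ℝ := ((2 * Real.pi) ^ ((Module.finrank ℝ E : ℝ) / 2))⁻¹ *
    ((2 * Real.pi * (2 * h)) ^ ((Module.finrank ℝ E : ℝ) / 2))⁻¹ *
    ((Real.pi / (h / (1 - h))) ^ ((Module.finrank ℝ E : ℝ) / 2))⁻¹ with hC
  have hC0 : 0 < C := by
    have := div_pos hh h1'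
    positivity
  set m : Measure (E × ℝ) := (volume : Measure E).prod (volume.restrict (Set.Ioc (0 : ℝ) 1))
  have hmix : ∀ x y : E, gaussianDensity 1 x * acceptedDensity h x y
      = C * ∫ ω, mixtureComponent h ω x * mixtureComponent h ω y ∂m := by
    intro x y
    have : (0 : ℝ) < (Real.pi / (h / (1 - h))) ^ ((Module.finrank ℝ E : ℝ) / 2) := by
      have := div_pos hh h1'
      positivity
    rw [integral_mixtureComponent_mul hh h1, gaussianDensity_mul_acceptedDensity hh, hC]
    field_simp
  have hpos : ∀ (ω : E × ℝ) (x : E), 0 ≤ mixtureComponent h ω x := fun ω x =>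
    mul_nonneg (Real.exp_pos _).le (mul_nonneg (Real.exp_pos _).le
      (Set.indicator_nonneg (fun _ _ => zero_le_one) _))
  have hjoint := integrable_gaussianDensity_mul_acceptedDensity (E := E) hh
  have hu : Integrable (fun q : (E × E) × (E × ℝ) =>
      mixtureComponent h q.2 q.1.1 * mixtureComponent h q.2 q.1.2)
      (((volume : Measure E).prod volume).prod m) := by
    have e1 : Measurable fun q : (E × E) × (E × ℝ) => (q.2, q.1.1) := by fun_prop
    have e2 : Measurable fun q : (E × E) × (E × ℝ) => (q.2, q.1.2) := by fun_prop
    have hm1 := (measurable_mixtureComponent (E := E) h).comp e1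
    have hm2 := (measurable_mixtureComponent (E := E) h).comp e2
    simp only [Function.comp_def] at hm1 hm2
    rw [integrable_prod_iff (Measurable.aestronglyMeasurable (by exact hm1.mul hm2))]
    refine ⟨ae_of_all _ fun p => integrable_mixtureComponent_mul hh h1 p.1 p.2, ?_⟩
    refine (hjoint.const_mul C⁻¹).congr (ae_of_all _ fun p => ?_)
    simp only [Real.norm_eq_abs, abs_of_nonneg (mul_nonneg (hpos _ _) (hpos _ _))]
    rw [hmix, inv_mul_cancel_left₀ hC0.ne']
  have key := integral_mixture_nonneg hu hF hM
  have hFF : Integrable (fun p : E × E => F p.1 * F p.2 *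
      (gaussianDensity 1 p.1 * acceptedDensity h p.1 p.2)) ((volume : Measure E).prod volume) := by
    refine hjoint.bdd_mul (c := M * M) (by fun_prop) (ae_of_all _ fun q => ?_)
    rw [Real.norm_eq_abs, abs_mul]
    exact mul_le_mul (hM _) (hM _) (abs_nonneg _) ((abs_nonneg _).trans (hM q.1))
  have heq : ∫ x, F x * (∫ y, acceptedDensity h x y * F y) ∂(stdGaussian E)
      = C * ∫ p : E × E, F p.1 * F p.2 *
        ∫ ω, mixtureComponent h ω p.1 * mixtureComponent h ω p.2 ∂m
          ∂((volume : Measure E).prod volume) := by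
    rw [integral_stdGaussian_eq, ← integral_const_mul]
    have h2 : ∀ p : E × E, C * (F p.1 * F p.2 *
        ∫ ω, mixtureComponent h ω p.1 * mixtureComponent h ω p.2 ∂m)
        = F p.1 * F p.2 * (gaussianDensity 1 p.1 * acceptedDensity h p.1 p.2) := fun p => by
      rw [hmix]; ring
    simp_rw [h2]
    rw [integral_prod _ hFF]
    refine integral_congr_ae (ae_of_all _ fun x => ?_)
    simp only
    rw [← mul_assoc, ← integral_const_mul]
    refine integral_congr_ae (ae_of_all _ fun y => ?_)
    simp only
    ring
  rw [heq]
  exact mul_nonneg hC0.le key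

end AcceptedDensity

/-! ### The MALA kernel of the Gaussian target: Markov property, reversibility, positivity. -/

section GaussianKernel

variable {d : ℕ}

theorem gradient_gaussianPotential (x : EuclideanSpace ℝ (Fin d)) :
    gradient (gaussianPotential d) x = x := by
  apply HasGradientAt.gradient
  rw [hasGradientAt_iff_hasFDerivAt]
  have h := (hasStrictFDerivAt_norm_sq x).hasFDerivAt.const_mul (1 / 2 : ℝ)
  have hfun : gaussianPotential d = fun y => 1 / 2 * ‖y‖ ^ 2 := by
    funext y
    rw [gaussianPotential]
    ring
  rw [hfun]
  refine h.congr_fderiv ?_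
  ext y
  simp

theorem proposalDensity_gaussianPotential (h : ℝ) (x y : EuclideanSpace ℝ (Fin d)) :
    proposalDensity (gaussianPotential d) h x y = gaussianDensity (2 * h) (y - (1 - h) • x) := by
  unfold proposalDensity gaussianDensity
  rw [gradient_gaussianPotential, finrank_euclideanSpace_fin, one_div,
    show y - x + h • x = y - (1 - h) • x by module]
  congr 3 <;> ring

/-- The inner products in the two proposal densities are equal and cancel. The coefficient of `‖y‖²
- ‖x‖²` is `-1/2 + (1 - (1 - h)²) / (4 h) = -h/4`: the orders below `h` cancel too. -/
theorem acceptRatio_gaussianPotential {h : ℝ} (hh : 0 < h) (x y : EuclideanSpace ℝ (Fin d)) :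
    acceptRatio (gaussianPotential d) h x y
      = Real.exp (-(h / 4) * (‖y‖ ^ 2 - ‖x‖ ^ 2)) := by
  unfold acceptRatio
  rw [proposalDensity_gaussianPotential, proposalDensity_gaussianPotential, gaussianDensity,
    gaussianDensity, mul_left_comm, mul_left_comm (Real.exp (-gaussianPotential d x)),
    mul_div_mul_left _ _ (by positivity), ← Real.exp_add, ← Real.exp_add, ← Real.exp_sub]
  congr 1
  unfold gaussianPotential
  simp only [norm_sub_sq_real, norm_smul, inner_smul_right, mul_pow, Real.norm_eq_abs, sq_abs]
  rw [real_inner_comm x y]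
  field_simp
  ring

theorem proposalDensity_mul_acceptProb {h : ℝ} (hh : 0 < h) (x y : EuclideanSpace ℝ (Fin d)) :
    proposalDensity (gaussianPotential d) h x y * acceptProb (gaussianPotential d) h x y
      = acceptedDensity h x y := by
  rw [acceptProb, acceptRatio_gaussianPotential hh, proposalDensity_gaussianPotential,
    acceptedDensity]

theorem acceptMass_eq {h : ℝ} (hh : 0 < h) (x : EuclideanSpace ℝ (Fin d)) :
    acceptMass (gaussianPotential d) h x = ENNReal.ofReal (∫ y, acceptedDensity h x y) := by
  unfold acceptMass
  simp_rw [proposalDensity_mul_acceptProb hh]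
  exact (ofReal_integral_eq_lintegral_ofReal (integrable_acceptedDensity hh x)
    (ae_of_all _ fun y => acceptedDensity_nonneg hh x y)).symm

theorem acceptMass_le_one {h : ℝ} (hh : 0 < h) (x : EuclideanSpace ℝ (Fin d)) :
    acceptMass (gaussianPotential d) h x ≤ 1 := by
  rw [acceptMass_eq hh]
  exact ENNReal.ofReal_le_one.2 (integral_acceptedDensity_le_one hh x)

theorem gaussianKernel_apply {h : ℝ} (hh : 0 < h) (x : EuclideanSpace ℝ (Fin d)) :
    gaussianKernel d h x = volume.withDensity (fun y => ENNReal.ofReal (acceptedDensity h x y))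
      + (1 - acceptMass (gaussianPotential d) h x) • Measure.dirac x := by
  simp_rw [← proposalDensity_mul_acceptProb hh]
  rfl

theorem isMarkovKernel_gaussianKernel {h : ℝ} (hh : 0 < h) :
    IsMarkovKernel (gaussianKernel d h) := by
  refine ⟨fun x => ⟨?_⟩⟩
  rw [gaussianKernel_apply hh, Measure.add_apply, withDensity_apply _ MeasurableSet.univ,
    Measure.restrict_univ, Measure.smul_apply, measure_univ, smul_eq_mul, mul_one]
  have : ∫⁻ y, ENNReal.ofReal (acceptedDensity h x y)
      = acceptMass (gaussianPotential d) h x := by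
    unfold acceptMass
    simp_rw [proposalDensity_mul_acceptProb hh]
  rw [this]
  exact add_tsub_cancel_of_le (acceptMass_le_one hh x)

theorem measurable_acceptMass {h : ℝ} (hh : 0 < h) :
    Measurable (acceptMass (gaussianPotential d) h) := by
  unfold acceptMass
  simp_rw [proposalDensity_mul_acceptProb hh]
  exact Measurable.lintegral_prod_right'
    (f := fun p : EuclideanSpace ℝ (Fin d) × EuclideanSpace ℝ (Fin d) =>
      ENNReal.ofReal (acceptedDensity h p.1 p.2))
    (continuous_acceptedDensity h).measurable.ennreal_ofReal

theorem isReversible_gaussianKernel {h : ℝ} (hh : 0 < h) :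
    (gaussianKernel d h).IsReversible (stdGaussian (EuclideanSpace ℝ (Fin d))) := by
  have hcont := (continuous_acceptedDensity (E := EuclideanSpace ℝ (Fin d)) h).measurable
  -- The flow from `A` to `B` is a double integral of a symmetric density plus a rejection term
  -- living on `A ∩ B`; each is symmetric in `A` and `B`.
  have hsplit : ∀ A B : Set (EuclideanSpace ℝ (Fin d)), MeasurableSet A → MeasurableSet B →
      ∫⁻ x in A, gaussianKernel d h x B ∂(stdGaussian (EuclideanSpace ℝ (Fin d)))
      = (∫⁻ x in A, ∫⁻ y in B, ENNReal.ofReal (gaussianDensity 1 x * acceptedDensity h x y))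
        + ∫⁻ x, A.indicator 1 x * (B.indicator 1 x * (1 - acceptMass (gaussianPotential d) h x))
            ∂(stdGaussian (EuclideanSpace ℝ (Fin d))) := by
    intro A B hA hB
    have hk : ∀ x, gaussianKernel d h x B = (∫⁻ y in B, ENNReal.ofReal (acceptedDensity h x y))
        + B.indicator 1 x * (1 - acceptMass (gaussianPotential d) h x) := by
      intro x
      rw [gaussianKernel_apply hh, Measure.add_apply, withDensity_apply _ hB,
        Measure.smul_apply, Measure.dirac_apply' _ hB, smul_eq_mul, mul_comm (1 - _)]
    have hm1 : Measurable fun x : EuclideanSpace ℝ (Fin d) =>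
        ∫⁻ y in B, ENNReal.ofReal (acceptedDensity h x y) :=
      Measurable.lintegral_prod_right' (ν := volume.restrict B)
        (f := fun p : EuclideanSpace ℝ (Fin d) × EuclideanSpace ℝ (Fin d) =>
          ENNReal.ofReal (acceptedDensity h p.1 p.2)) hcont.ennreal_ofReal
    simp_rw [hk]
    rw [lintegral_add_left hm1]
    congr 1
    · rw [← lintegral_indicator hA, lintegral_stdGaussian_eq (hm1.indicator hA),
        ← lintegral_indicator hA]
      refine lintegral_congr fun x => ?_
      by_cases hx : x ∈ A
      · simp only [hx, Set.indicator_of_mem]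
        rw [← lintegral_const_mul]
        · simp_rw [ENNReal.ofReal_mul (gaussianDensity_pos one_pos x).le]
        · exact (hcont.comp measurable_prodMk_left).ennreal_ofReal
      · simp [hx]
    · rw [← lintegral_indicator hA]
      refine lintegral_congr fun x => ?_
      by_cases hx : x ∈ A <;> simp [hx]
  intro A B hA hB
  rw [hsplit A B hA hB, hsplit B A hB hA]
  congr 1
  · rw [lintegral_lintegral_swap]
    · simp_rw [gaussianDensity_mul_acceptedDensity_comm hh]
    · have : Measurable fun p : EuclideanSpace ℝ (Fin d) × EuclideanSpace ℝ (Fin d) =>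
          ENNReal.ofReal (gaussianDensity 1 p.1 * acceptedDensity h p.1 p.2) :=
        ((((continuous_gaussianDensity 1).measurable.comp measurable_fst).mul
          hcont)).ennreal_ofReal
      exact this.aemeasurable
  · refine lintegral_congr fun x => ?_
    ring

theorem integrable_acceptedDensity_mul {h : ℝ} (hh : 0 < h) (x : EuclideanSpace ℝ (Fin d))
    {F : EuclideanSpace ℝ (Fin d) → ℝ} (hF : Measurable F) {M : ℝ} (hM : ∀ x, |F x| ≤ M) :
    Integrable fun y => acceptedDensity h x y * F y :=
  (integrable_acceptedDensity hh x).mul_bdd (c := M) hF.aestronglyMeasurable (ae_of_all _ hM)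

theorem kernelMap_gaussianKernel {h : ℝ} (hh : 0 < h) (x : EuclideanSpace ℝ (Fin d))
    {F : EuclideanSpace ℝ (Fin d) → ℝ} (hF : Measurable F) {M : ℝ} (hM : ∀ x, |F x| ≤ M) :
    kernelMap (gaussianKernel d h) F x = (∫ y, acceptedDensity h x y * F y)
      + (1 - acceptMass (gaussianPotential d) h x).toReal * F x := by
  have hm : Measurable fun y => ENNReal.ofReal (acceptedDensity h x y) :=
    ((continuous_acceptedDensity h).measurable.comp measurable_prodMk_left).ennreal_ofReal
  have hfin : ∀ᵐ y : EuclideanSpace ℝ (Fin d), ENNReal.ofReal (acceptedDensity h x y) < ∞ :=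
    ae_of_all _ fun _ => ENNReal.ofReal_lt_top
  have hto : ∀ y, (ENNReal.ofReal (acceptedDensity h x y)).toReal = acceptedDensity h x y :=
    fun y => ENNReal.toReal_ofReal (acceptedDensity_nonneg hh x y)
  rw [kernelMap, gaussianKernel_apply hh, integral_add_measure, integral_smul_measure,
    integral_dirac, integral_withDensity_eq_integral_toReal_smul hm hfin]
  · simp_rw [hto, smul_eq_mul]
  · rw [integrable_withDensity_iff_integrable_smul' hm hfin]
    simp_rw [hto, smul_eq_mul]
    exact integrable_acceptedDensity_mul hh x hF hM
  · exact (integrable_dirac (by finiteness)).smul_measure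
      (ne_top_of_le_ne_top ENNReal.one_ne_top tsub_le_self)

/-- The kernel is its accepted part, positive by the mixture representation, plus multiplication by
the rejection probability `r ≥ 0`. -/
theorem integral_mul_kernelMap_gaussianKernel_nonneg {h : ℝ} (hh : 0 < h) (h1 : h < 1)
    {F : EuclideanSpace ℝ (Fin d) → ℝ} (hF : Measurable F) (hb : ∃ M, ∀ x, |F x| ≤ M) :
    0 ≤ ∫ x, F x * kernelMap (gaussianKernel d h) F x
      ∂(stdGaussian (EuclideanSpace ℝ (Fin d))) := by
  obtain ⟨M, hM⟩ := hb
  have hM0 : 0 ≤ M := (abs_nonneg _).trans (hM 0)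
  have := isMarkovKernel_gaussianKernel (d := d) hh
  set r : EuclideanSpace ℝ (Fin d) → ℝ :=
    fun x => (1 - acceptMass (gaussianPotential d) h x).toReal with hr
  have hrm : Measurable r := (measurable_const.sub (measurable_acceptMass hh)).ennreal_toReal
  have hr0 : ∀ x, 0 ≤ r x := fun x => ENNReal.toReal_nonneg
  have hr1 : ∀ x, r x ≤ 1 := fun x => by
    have := ENNReal.toReal_mono ENNReal.one_ne_top
      (tsub_le_self : 1 - acceptMass (gaussianPotential d) h x ≤ 1)
    simpa using this
  have hKM := abs_kernelMap_le (κ := gaussianKernel d h) hF hM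
  have hi2 : Integrable (fun x => F x * (r x * F x))
      (stdGaussian (EuclideanSpace ℝ (Fin d))) := by
    refine integrable_of_abs_le (by fun_prop) (M := M * (1 * M)) fun x => ?_
    rw [abs_mul, abs_mul, abs_of_nonneg (hr0 x)]
    gcongr
    exacts [hM x, hr1 x, hM x]
  have hi : Integrable (fun x => F x * kernelMap (gaussianKernel d h) F x)
      (stdGaussian (EuclideanSpace ℝ (Fin d))) := by
    refine integrable_of_abs_le (hF.mul (measurable_kernelMap hF)) (M := M * M) fun x => ?_
    rw [abs_mul]
    gcongr
    exacts [hM x, hKM x]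
  have heq : ∀ x, F x * kernelMap (gaussianKernel d h) F x - F x * (r x * F x)
      = F x * ∫ y, acceptedDensity h x y * F y := fun x => by
    rw [kernelMap_gaussianKernel hh x hF hM]
    ring
  have hA := integral_acceptedDensity_bilinear_nonneg hh h1 hF hM
  simp_rw [← heq] at hA
  rw [integral_sub hi hi2] at hA
  have hB : 0 ≤ ∫ x, F x * (r x * F x) ∂(stdGaussian (EuclideanSpace ℝ (Fin d))) :=
    integral_nonneg fun x => by
      have := mul_nonneg (hr0 x) (mul_self_nonneg (F x))
      dsimp only [Pi.zero_apply]
      linarith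
  linarith

theorem integral_acceptedDensity_mul_le {h : ℝ} (hh : 0 < h) (x : EuclideanSpace ℝ (Fin d))
    {F : EuclideanSpace ℝ (Fin d) → ℝ} (hF : Measurable F) {M : ℝ} (h0 : ∀ x, 0 ≤ F x)
    (hM : ∀ x, F x ≤ M) :
    ∫ y, acceptedDensity h x y * F y ≤ ∫ y, F y ∂(gaussianKernel d h x) := by
  have := kernelMap_gaussianKernel hh x hF fun x => abs_le_of_mem_Icc (fun x => ⟨h0 x, hM x⟩) x
  rw [kernelMap] at this
  rw [this]
  exact le_add_of_nonneg_right (mul_nonneg ENNReal.toReal_nonneg (h0 x))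

end GaussianKernel

/-! ### Barker moves: lower bound on their mass and Fisher information. -/

section Barker

variable {E : Type*} [NormedAddCommGroup E] [InnerProductSpace ℝ E] [FiniteDimensional ℝ E]
  [MeasurableSpace E] [BorelSpace E]

/-- The Barker acceptance probability `1 / (1 + 1 / a(x, w))`, a smooth lower bound of the
Metropolis one. -/
def barkerProb (h : ℝ) (x w : E) : ℝ := (1 + Real.exp (h / 4 * (‖w‖ ^ 2 - ‖x‖ ^ 2)))⁻¹

/-- The density of the moves accepted with the Barker probability. -/
def barkerDensity (h : ℝ) (x w : E) : ℝ :=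
  gaussianDensity (2 * h) (w - (1 - h) • x) * barkerProb h x w

/-- The value of `∫ Q(x, w) / a(x, w) dw`. -/
def inverseRatioMean (h : ℝ) (x : E) : ℝ :=
  ((1 - h ^ 2) ^ ((Module.finrank ℝ E : ℝ) / 2))⁻¹ * Real.exp (-(h ^ 2 / (2 * (1 + h))) * ‖x‖ ^ 2)

theorem barkerProb_pos (h : ℝ) (x w : E) : 0 < barkerProb h x w := by
  unfold barkerProb
  positivity

theorem barkerProb_le_one (h : ℝ) (x w : E) : barkerProb h x w ≤ 1 :=
  inv_le_one_of_one_le₀ (by linarith [Real.exp_pos (h / 4 * (‖w‖ ^ 2 - ‖x‖ ^ 2))])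

theorem one_sub_barkerProb (h : ℝ) (x w : E) :
    1 - barkerProb h x w = barkerProb h x w * Real.exp (h / 4 * (‖w‖ ^ 2 - ‖x‖ ^ 2)) := by
  have := Real.exp_pos (h / 4 * (‖w‖ ^ 2 - ‖x‖ ^ 2))
  unfold barkerProb
  field_simp
  ring

theorem barkerDensity_pos {h : ℝ} (hh : 0 < h) (x w : E) : 0 < barkerDensity h x w :=
  mul_pos (gaussianDensity_pos (by positivity) _) (barkerProb_pos h x w)

theorem barkerDensity_le_gaussianDensity {h : ℝ} (hh : 0 < h) (x w : E) :
    barkerDensity h x w ≤ gaussianDensity (2 * h) (w - (1 - h) • x) :=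
  mul_le_of_le_one_right (gaussianDensity_pos (by positivity) _).le (barkerProb_le_one h x w)

/-- Since `1 / (1 + 1/a) ≤ min 1 a`, a Dirichlet energy computed with Barker moves bounds that of
MALA from below, and it has no kink at `a = 1`. -/
theorem barkerDensity_le_acceptedDensity {h : ℝ} (hh : 0 < h) (x w : E) :
    barkerDensity h x w ≤ acceptedDensity h x w := by
  refine mul_le_mul_of_nonneg_left (le_min (barkerProb_le_one h x w) ?_)
    (gaussianDensity_pos (by positivity) _).le
  rw [neg_mul, Real.exp_neg]
  exact inv_anti₀ (Real.exp_pos _) (by linarith)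

theorem continuous_barkerProb (h : ℝ) : Continuous fun p : E × E => barkerProb h p.1 p.2 := by
  unfold barkerProb
  refine Continuous.inv₀ (by fun_prop) fun p => ?_
  positivity

theorem continuous_barkerDensity (h : ℝ) :
    Continuous fun p : E × E => barkerDensity h p.1 p.2 := by
  unfold barkerDensity
  exact ((continuous_gaussianDensity (2 * h)).comp (by fun_prop)).mul (continuous_barkerProb h)

theorem measurable_barkerProb_right (h : ℝ) (x : E) : Measurable (barkerProb h x) := by
  unfold barkerProb
  fun_prop

theorem measurable_barkerDensity_right (h : ℝ) (x : E) : Measurable (barkerDensity h x) := by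
  have h1 : Continuous fun w : E => gaussianDensity (2 * h) (w - (1 - h) • x) :=
    (continuous_gaussianDensity (2 * h)).comp (continuous_id.sub continuous_const)
  exact h1.measurable.mul (measurable_barkerProb_right h x)

theorem integrable_gaussianDensity_sub {h : ℝ} (hh : 0 < h) (x : E) :
    Integrable fun w : E => gaussianDensity (2 * h) (w - (1 - h) • x) :=
  (integrable_gaussianDensity (by positivity)).comp_sub_right _

theorem integral_gaussianDensity_sub {h : ℝ} (hh : 0 < h) (x : E) :
    ∫ w : E, gaussianDensity (2 * h) (w - (1 - h) • x) = 1 := by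
  rw [integral_sub_right_eq_self (gaussianDensity (2 * h)),
    integral_gaussianDensity (by positivity)]

theorem integrable_barkerDensity {h : ℝ} (hh : 0 < h) (x : E) :
    Integrable (barkerDensity h x) := by
  refine Integrable.mono' (integrable_gaussianDensity_sub hh x)
    (measurable_barkerDensity_right h x).aestronglyMeasurable (ae_of_all _ fun w => ?_)
  rw [Real.norm_eq_abs, abs_of_pos (barkerDensity_pos hh x w)]
  exact barkerDensity_le_gaussianDensity hh x w

theorem integrable_barkerDensity_mul {h : ℝ} (hh : 0 < h) (x : E) {F : E → ℝ}
    (hF : Measurable F) {M : ℝ} (hM : ∀ x, |F x| ≤ M) :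
    Integrable fun w => barkerDensity h x w * F w :=
  (integrable_barkerDensity hh x).mul_bdd (c := M) hF.aestronglyMeasurable (ae_of_all _ hM)

theorem gaussianDensity_mul_exp_eq {h : ℝ} (hh : 0 < h) (x w : E) :
    gaussianDensity (2 * h) (w - (1 - h) • x) * Real.exp (h / 4 * (‖w‖ ^ 2 - ‖x‖ ^ 2))
      = (((2 * Real.pi * (2 * h)) ^ ((Module.finrank ℝ E : ℝ) / 2))⁻¹ *
          Real.exp (-(((1 - h) ^ 2 + h ^ 2) / (4 * h)) * ‖x‖ ^ 2)) *
        Real.exp (-((1 - h ^ 2) / (4 * h)) * ‖w‖ ^ 2 + inner ℝ (((1 - h) / (2 * h)) • x) w) := by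
  unfold gaussianDensity
  rw [mul_assoc, ← Real.exp_add, mul_assoc _ (Real.exp _) (Real.exp _), ← Real.exp_add,
    norm_sub_sq_real, norm_smul, inner_smul_right, inner_smul_left, mul_pow, Real.norm_eq_abs,
    sq_abs, real_inner_comm, conj_trivial]
  congr 2
  field_simp
  ring

theorem integrable_gaussianDensity_mul_exp {h : ℝ} (hh : 0 < h) (h1 : h < 1) (x : E) :
    Integrable fun w => gaussianDensity (2 * h) (w - (1 - h) • x)
      * Real.exp (h / 4 * (‖w‖ ^ 2 - ‖x‖ ^ 2)) := by
  simp_rw [gaussianDensity_mul_exp_eq hh]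
  exact (integrable_exp_neg_mul_sq_norm_add_inner
    (div_pos (by nlinarith) (by positivity)) _).const_mul _

theorem integral_gaussianDensity_mul_exp {h : ℝ} (hh : 0 < h) (h1 : h < 1) (x : E) :
    ∫ w, gaussianDensity (2 * h) (w - (1 - h) • x) * Real.exp (h / 4 * (‖w‖ ^ 2 - ‖x‖ ^ 2))
      = inverseRatioMean h x := by
  have h2 : 0 < 1 - h ^ 2 := by nlinarith
  simp_rw [gaussianDensity_mul_exp_eq hh]
  rw [integral_const_mul, integral_exp_neg_mul_sq_norm_add_inner
    (div_pos h2 (by positivity))]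
  have e1 : (Real.pi / ((1 - h ^ 2) / (4 * h))) ^ ((Module.finrank ℝ E : ℝ) / 2)
      = (2 * Real.pi * (2 * h)) ^ ((Module.finrank ℝ E : ℝ) / 2)
        * ((1 - h ^ 2) ^ ((Module.finrank ℝ E : ℝ) / 2))⁻¹ := by
    rw [← Real.inv_rpow h2.le, ← Real.mul_rpow (by positivity) (by positivity)]
    congr 1
    field_simp
    ring
  have e2 : Real.exp (-(((1 - h) ^ 2 + h ^ 2) / (4 * h)) * ‖x‖ ^ 2)
      * Real.exp (‖((1 - h) / (2 * h)) • x‖ ^ 2 / (4 * ((1 - h ^ 2) / (4 * h))))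
      = Real.exp (-(h ^ 2 / (2 * (1 + h))) * ‖x‖ ^ 2) := by
    rw [← Real.exp_add, norm_smul, mul_pow, Real.norm_eq_abs, sq_abs]
    congr 1
    rw [show 1 - h ^ 2 = (1 - h) * (1 + h) by ring]
    field_simp
    ring
  rw [e1, inverseRatioMean, ← e2]
  field_simp

theorem inverseRatioMean_pos {h : ℝ} (hh : 0 < h) (h1 : h < 1) (x : E) :
    0 < inverseRatioMean h x := by
  have h2 : 0 < 1 - h ^ 2 := by nlinarith
  unfold inverseRatioMean
  positivity

/-- The mass of the moves accepted with the Barker probability. -/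
def barkerMass (h : ℝ) (x : E) : ℝ := ∫ w, barkerDensity h x w

/-- Jensen's inequality for the convex function `t ↦ 1 / (1 + t)` of the inverse ratio `t`, whose
mean under the proposal is `s`. It is proved by integrating the tangent line at `s`, where the
linear term has mean zero. -/
theorem inv_one_add_inverseRatioMean_le_barkerMass {h : ℝ} (hh : 0 < h) (h1 : h < 1) (x : E) :
    (1 + inverseRatioMean h x)⁻¹ ≤ barkerMass h x := by
  set s := inverseRatioMean h x with hs
  have hs0 : 0 < s := inverseRatioMean_pos hh h1 x
  have hpt : ∀ w, (1 + s)⁻¹ * gaussianDensity (2 * h) (w - (1 - h) • x)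
      - ((1 + s) ^ 2)⁻¹ * (gaussianDensity (2 * h) (w - (1 - h) • x)
        * Real.exp (h / 4 * (‖w‖ ^ 2 - ‖x‖ ^ 2)) - s * gaussianDensity (2 * h) (w - (1 - h) • x))
      ≤ barkerDensity h x w := by
    intro w
    have hq := (gaussianDensity_pos (s := 2 * h) (by positivity) (w - (1 - h) • x)).le
    have ht := Real.exp_pos (h / 4 * (‖w‖ ^ 2 - ‖x‖ ^ 2))
    unfold barkerDensity barkerProb
    set t := Real.exp (h / 4 * (‖w‖ ^ 2 - ‖x‖ ^ 2))
    set q := gaussianDensity (2 * h) (w - (1 - h) • x)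
    have : (1 + s)⁻¹ - ((1 + s) ^ 2)⁻¹ * (t - s) ≤ (1 + t)⁻¹ := by
      have e : (1 + t)⁻¹ - ((1 + s)⁻¹ - ((1 + s) ^ 2)⁻¹ * (t - s))
          = (t - s) ^ 2 / ((1 + t) * (1 + s) ^ 2) := by
        field_simp
        ring
      have : 0 ≤ (t - s) ^ 2 / ((1 + t) * (1 + s) ^ 2) := by positivity
      linarith
    calc _ = q * ((1 + s)⁻¹ - ((1 + s) ^ 2)⁻¹ * (t - s)) := by ring
      _ ≤ _ := mul_le_mul_of_nonneg_left this hq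
  have i1 := integrable_gaussianDensity_sub hh x
  have i2 := integrable_gaussianDensity_mul_exp hh h1 x
  have := integral_mono (μ := volume)
    ((i1.const_mul (1 + s)⁻¹).sub ((i2.sub (i1.const_mul s)).const_mul ((1 + s) ^ 2)⁻¹))
    (integrable_barkerDensity hh x) hpt
  simp only [Pi.sub_apply] at this
  rw [integral_sub (i1.const_mul _) (by exact (i2.sub (i1.const_mul s)).const_mul _),
    integral_const_mul, integral_const_mul, integral_sub i2 (i1.const_mul s), integral_const_mul,
    integral_gaussianDensity_sub hh, integral_gaussianDensity_mul_exp hh h1, ← hs, mul_one, mul_one, sub_self, mul_zero,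
    sub_zero] at this
  exact this

theorem barkerMass_pos {h : ℝ} (hh : 0 < h) (h1 : h < 1) (x : E) : 0 < barkerMass h x :=
  (inv_pos.2 (by linarith [inverseRatioMean_pos hh h1 x])).trans_le
    (inv_one_add_inverseRatioMean_le_barkerMass hh h1 x)

theorem inv_rpow_one_sub_le {t a : ℝ} (h0 : 0 ≤ t) (h1 : t ≤ 1 / 4) (ha : 0 ≤ a) :
    ((1 - t) ^ a)⁻¹ ≤ Real.exp (a * (t + t ^ 2)) := by
  have h2 : 0 < 1 - t := by linarith
  rw [← Real.inv_rpow h2.le, mul_comm, Real.exp_mul]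
  refine Real.rpow_le_rpow (by positivity) ?_ ha
  rw [inv_le_iff_one_le_mul₀ h2]
  have h3 := Real.quadratic_le_exp_of_nonneg (x := t + t ^ 2) (by positivity)
  have h4 : 1 ≤ (1 + (t + t ^ 2) + (t + t ^ 2) ^ 2 / 2) * (1 - t) := by
    have : 0 ≤ 1 / 2 - t / 2 - t ^ 2 / 2 - t ^ 3 / 2 := by nlinarith [mul_nonneg h0 h0]
    nlinarith [mul_nonneg (sq_nonneg t) this]
  exact h4.trans (mul_le_mul_of_nonneg_right h3 h2.le)

theorem inverseRatioMean_le_exp {h : ℝ} (hh : 0 < h) (h1 : h ≤ 1 / 4) (x : E) :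
    inverseRatioMean h x ≤ Real.exp (Module.finrank ℝ E / 2 * (h ^ 2 + h ^ 4)
      - h ^ 2 / (2 * (1 + h)) * ‖x‖ ^ 2) := by
  have := inv_rpow_one_sub_le (t := h ^ 2) (a := (Module.finrank ℝ E : ℝ) / 2) (by positivity)
    (by nlinarith) (by positivity)
  rw [sub_eq_add_neg, Real.exp_add, inverseRatioMean, neg_mul]
  refine mul_le_mul_of_nonneg_right (this.trans_eq ?_) (Real.exp_pos _).le
  ring_nf

/-- A crude bound valid at every point, used only on the exceptional set of small norms. -/
theorem inverseRatioMean_le_exp_finrank {h : ℝ} (hh : 0 < h) (h1 : h ≤ 1 / 4) (x : E) :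
    inverseRatioMean h x ≤ Real.exp (h ^ 2 * Module.finrank ℝ E) := by
  refine (inverseRatioMean_le_exp hh h1 x).trans (Real.exp_le_exp.2 ?_)
  have e1 : h ^ 4 ≤ h ^ 2 := pow_le_pow_of_le_one hh.le (by linarith) (by norm_num)
  have e2 : 0 ≤ h ^ 2 / (2 * (1 + h)) * ‖x‖ ^ 2 := by positivity
  nlinarith

/-- With `n` the dimension, the leading terms `h² n / 2` of the normalization and of the exponential
cancel when `‖x‖²` is near `n`. What is left is of order `h³ n`, which is why steps of size
`n^(-1/3)` are admissible. Only a lower bound on `‖x‖` is needed: a large norm favours acceptance.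
-/
theorem inverseRatioMean_le_of_le_sq_norm {h L : ℝ} (hh : 0 < h) (h1 : h ≤ 1 / 4)
    (x : E) (hx : Module.finrank ℝ E - L ≤ ‖x‖ ^ 2) (hL : 0 ≤ L) :
    inverseRatioMean h x ≤ Real.exp (h ^ 3 * Module.finrank ℝ E + h ^ 2 * L / 2) := by
  refine (inverseRatioMean_le_exp hh h1 x).trans (Real.exp_le_exp.2 ?_)
  set n : ℝ := (Module.finrank ℝ E : ℝ)
  have hn0 : 0 ≤ n := by positivity
  have e1 : h ^ 4 ≤ h ^ 3 := pow_le_pow_of_le_one hh.le (by linarith) (by norm_num)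
  have e2 : h ^ 2 / (2 * (1 + h)) * (n - L) ≤ h ^ 2 / (2 * (1 + h)) * ‖x‖ ^ 2 :=
    mul_le_mul_of_nonneg_left hx (by positivity)
  have e3 : h ^ 2 / (2 * (1 + h)) ≤ h ^ 2 / 2 := by
    apply div_le_div_of_nonneg_left (by positivity) (by norm_num)
    linarith
  have e4 : h ^ 2 / 2 - h ^ 3 / 2 ≤ h ^ 2 / (2 * (1 + h)) := by
    rw [le_div_iff₀ (by positivity)]
    nlinarith [pow_pos hh 4]
  nlinarith [mul_le_mul_of_nonneg_right e3 hL, mul_le_mul_of_nonneg_right e4 hn0,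
    mul_le_mul_of_nonneg_right e1 hn0]

/-- The acceptance part of the score grows like `‖x‖`, and this compensates it. For `‖x‖² ≤ 4 n` the
condition `h³ n ≤ 1` is enough; beyond, the inverse ratio mean decays like `exp (-h² ‖x‖² / 8)`. -/
theorem sq_norm_mul_min_inverseRatioMean_le {h : ℝ} (hh : 0 < h) (h1 : h ≤ 1 / 4)
    (hn : h ^ 3 * Module.finrank ℝ E ≤ 1) (x : E) :
    h ^ 2 * ‖x‖ ^ 2 * min 1 (inverseRatioMean h x) ≤ 8 / h := by
  set n : ℝ := (Module.finrank ℝ E : ℝ) with hndef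
  have hn0 : 0 ≤ n := by positivity
  have hp : 0 ≤ h ^ 2 * ‖x‖ ^ 2 := by positivity
  rcases le_total (‖x‖ ^ 2) (4 * n) with hx | hx
  · refine (mul_le_of_le_one_right hp (min_le_left _ _)).trans ?_
    rw [le_div_iff₀ hh]
    nlinarith [mul_le_mul_of_nonneg_left hx (by positivity : 0 ≤ h ^ 3)]
  · have e0 : inverseRatioMean h x ≤ Real.exp (-(h ^ 2 * ‖x‖ ^ 2 / 8)) := by
      refine (inverseRatioMean_le_exp hh h1 x).trans (Real.exp_le_exp.2 ?_)
      rw [← hndef]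
      have e1 : h ^ 4 ≤ h ^ 2 := pow_le_pow_of_le_one hh.le (by linarith) (by norm_num)
      have e2 : 3 / 8 * h ^ 2 ≤ h ^ 2 / (2 * (1 + h)) := by
        rw [le_div_iff₀ (by positivity)]
        nlinarith [sq_nonneg h]
      nlinarith [mul_le_mul_of_nonneg_right e2 (sq_nonneg ‖x‖),
        mul_le_mul_of_nonneg_left hx (sq_nonneg h), mul_le_mul_of_nonneg_right e1 hn0]
    have e3 : h ^ 2 * ‖x‖ ^ 2 / 8 * Real.exp (-(h ^ 2 * ‖x‖ ^ 2 / 8)) ≤ 1 := by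
      rw [Real.exp_neg, ← div_eq_mul_inv, div_le_one (Real.exp_pos _)]
      linarith [Real.add_one_le_exp (h ^ 2 * ‖x‖ ^ 2 / 8)]
    calc h ^ 2 * ‖x‖ ^ 2 * min 1 (inverseRatioMean h x)
        ≤ h ^ 2 * ‖x‖ ^ 2 * Real.exp (-(h ^ 2 * ‖x‖ ^ 2 / 8)) :=
          mul_le_mul_of_nonneg_left ((min_le_right _ _).trans e0) hp
      _ ≤ 8 := by linarith
      _ ≤ 8 / h := by rw [le_div_iff₀ hh]; linarith

/-- The gradient of `log (barkerDensity h x w)` in `x`. -/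
def barkerScore (h : ℝ) (x w : E) : E :=
  ((1 - h) / (2 * h)) • (w - (1 - h) • x) + ((1 - barkerProb h x w) * (h / 2)) • x

theorem measurable_barkerScore_right (h : ℝ) (x : E) : Measurable (barkerScore h x) := by
  have := measurable_barkerProb_right h x
  unfold barkerScore
  fun_prop

theorem integrable_gaussianDensity_mul_inner_sq {h : ℝ} (hh : 0 < h) (x u : E) :
    Integrable fun w : E => gaussianDensity (2 * h) (w - (1 - h) • x)
      * (inner ℝ (w - (1 - h) • x) u) ^ 2 := by
  have h2 : 0 < 2 * h := by positivity
  have key : Integrable fun v : E => gaussianDensity (2 * h) v * (inner ℝ v u) ^ 2 := by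
    have hs : 0 < Real.sqrt (2 * h) := Real.sqrt_pos.2 h2
    rw [← integrable_comp_smul_iff volume _ hs.ne']
    simp_rw [gaussianDensity_smul h2, inner_smul_left, mul_pow]
    have h3 := integrable_inner_sq_stdGaussian u
    rw [← withDensity_gaussianDensity_one, integrable_withDensity_iff_integrable_smul'
      (continuous_gaussianDensity 1).measurable.ennreal_ofReal
      (ae_of_all _ fun _ => ENNReal.ofReal_lt_top)] at h3
    simp_rw [ENNReal.toReal_ofReal (gaussianDensity_pos one_pos _).le, smul_eq_mul] at h3
    refine (h3.const_mul (((Real.sqrt (2 * h)) ^ Module.finrank ℝ E)⁻¹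
      * Real.sqrt (2 * h) ^ 2)).congr (ae_of_all _ fun v => ?_)
    simp only [conj_trivial]
    ring
  exact key.comp_sub_right ((1 - h) • x)

theorem integral_gaussianDensity_mul_inner_sq {h : ℝ} (hh : 0 < h) (x u : E) :
    ∫ w : E, gaussianDensity (2 * h) (w - (1 - h) • x) * (inner ℝ (w - (1 - h) • x) u) ^ 2
      = 2 * h * ‖u‖ ^ 2 := by
  have h2 : 0 < 2 * h := by positivity
  rw [integral_gaussianDensity_sub_mul h2]
  simp_rw [add_sub_cancel_left, inner_smul_left, mul_pow, conj_trivial]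
  rw [integral_const_mul, integral_inner_sq_stdGaussian, Real.sq_sqrt h2.le]

theorem integrable_barkerDensity_mul_one_sub_sq {h : ℝ} (hh : 0 < h) (x : E) :
    Integrable fun w => barkerDensity h x w * (1 - barkerProb h x w) ^ 2 := by
  have hm := measurable_barkerProb_right h x
  refine integrable_barkerDensity_mul hh x (M := 1) (by fun_prop) fun w => ?_
  rw [abs_pow]
  refine pow_le_one₀ (abs_nonneg _) (abs_le.2 ⟨?_, ?_⟩)
  · linarith [barkerProb_le_one h x w]
  · linarith [barkerProb_pos h x w]

/-- The Barker rejection probability is at most 1 and at most the inverse ratio `1/a`; both bounds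
are integrated against the proposal. -/
theorem integral_barkerDensity_mul_one_sub_sq_le {h : ℝ} (hh : 0 < h) (h1 : h < 1) (x : E) :
    ∫ w, barkerDensity h x w * (1 - barkerProb h x w) ^ 2 ≤ min 1 (inverseRatioMean h x) := by
  have hi := integrable_barkerDensity_mul_one_sub_sq hh x
  have h01 : ∀ w, 0 ≤ 1 - barkerProb h x w := fun w => by linarith [barkerProb_le_one h x w]
  have h11 : ∀ w, 1 - barkerProb h x w ≤ 1 := fun w => by linarith [barkerProb_pos h x w]
  refine le_min ?_ ?_
  · refine le_trans ?_ (integral_gaussianDensity_sub hh x).le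
    refine integral_mono hi (integrable_gaussianDensity_sub hh x) fun w => ?_
    exact (mul_le_of_le_one_right (barkerDensity_pos hh x w).le
      (pow_le_one₀ (h01 w) (h11 w))).trans (barkerDensity_le_gaussianDensity hh x w)
  · rw [← integral_gaussianDensity_mul_exp hh h1 x]
    refine integral_mono hi (integrable_gaussianDensity_mul_exp hh h1 x) fun w => ?_
    have e1 : (1 - barkerProb h x w) ^ 2 ≤ 1 - barkerProb h x w := by nlinarith [h01 w, h11 w]
    have e2 : 1 - barkerProb h x w ≤ Real.exp (h / 4 * (‖w‖ ^ 2 - ‖x‖ ^ 2)) := by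
      rw [one_sub_barkerProb]
      exact mul_le_of_le_one_left (Real.exp_pos _).le (barkerProb_le_one h x w)
    exact mul_le_mul (barkerDensity_le_gaussianDensity hh x w) (e1.trans e2) (sq_nonneg _)
      (gaussianDensity_pos (by positivity) _).le

theorem barkerDensity_mul_inner_score_sq_le {h : ℝ} (hh : 0 < h) (h1 : h < 1) (x u w : E) :
    barkerDensity h x w * (inner ℝ (barkerScore h x w) u) ^ 2
      ≤ 1 / (2 * h ^ 2) * (gaussianDensity (2 * h) (w - (1 - h) • x)
          * (inner ℝ (w - (1 - h) • x) u) ^ 2)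
        + h ^ 2 / 2 * (inner ℝ x u) ^ 2 * (barkerDensity h x w * (1 - barkerProb h x w) ^ 2) := by
  have hb := (barkerDensity_pos hh x w).le
  have hbq := barkerDensity_le_gaussianDensity hh x w
  rw [barkerScore, inner_add_left, inner_smul_left, inner_smul_left]
  simp only [conj_trivial]
  set a : ℝ := inner ℝ (w - (1 - h) • x) u
  set c : ℝ := inner ℝ x u
  set s := 1 - barkerProb h x w
  have e1 : ((1 - h) / (2 * h) * a + s * (h / 2) * c) ^ 2
      ≤ 2 * ((1 - h) / (2 * h) * a) ^ 2 + 2 * (s * (h / 2) * c) ^ 2 := by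
    nlinarith [sq_nonneg ((1 - h) / (2 * h) * a - s * (h / 2) * c)]
  have e2 : 2 * ((1 - h) / (2 * h) * a) ^ 2 ≤ 1 / (2 * h ^ 2) * a ^ 2 := by
    have : 2 * ((1 - h) / (2 * h) * a) ^ 2 = (1 - h) ^ 2 * (1 / (2 * h ^ 2) * a ^ 2) := by
      field_simp
    rw [this]
    exact mul_le_of_le_one_left (by positivity) (pow_le_one₀ (by linarith) (by linarith))
  calc _ ≤ barkerDensity h x w * (1 / (2 * h ^ 2) * a ^ 2 + 2 * (s * (h / 2) * c) ^ 2) :=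
        mul_le_mul_of_nonneg_left (by linarith) hb
    _ = 1 / (2 * h ^ 2) * (barkerDensity h x w * a ^ 2)
        + h ^ 2 / 2 * c ^ 2 * (barkerDensity h x w * s ^ 2) := by ring
    _ ≤ _ := by gcongr

theorem integrable_barkerDensity_mul_inner_score_sq {h : ℝ} (hh : 0 < h) (h1 : h < 1)
    (x u : E) :
    Integrable fun w => barkerDensity h x w * (inner ℝ (barkerScore h x w) u) ^ 2 := by
  refine Integrable.mono' (((integrable_gaussianDensity_mul_inner_sq hh x u).const_mul
    (1 / (2 * h ^ 2))).add ((integrable_barkerDensity_mul_one_sub_sq hh x).const_mul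
      (h ^ 2 / 2 * (inner ℝ x u) ^ 2))) ?_ (ae_of_all _ fun w => ?_)
  · have hs := measurable_barkerScore_right h x
    have hb := measurable_barkerDensity_right h x
    exact (hb.mul ((hs.inner_const).pow_const 2)).aestronglyMeasurable
  · rw [Real.norm_eq_abs, abs_of_nonneg
      (mul_nonneg (barkerDensity_pos hh x w).le (sq_nonneg _))]
    exact barkerDensity_mul_inner_score_sq_le hh h1 x u w

/-- The Fisher information of the Barker moves is of the order of that of the proposal. -/
theorem integral_barkerDensity_mul_inner_score_sq_le {h : ℝ} (hh : 0 < h) (h1 : h ≤ 1 / 4)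
    (hn : h ^ 3 * Module.finrank ℝ E ≤ 1) (x u : E) :
    ∫ w, barkerDensity h x w * (inner ℝ (barkerScore h x w) u) ^ 2 ≤ 5 / h * ‖u‖ ^ 2 := by
  have h1' : h < 1 := by linarith
  have i1 := (integrable_gaussianDensity_mul_inner_sq hh x u).const_mul (1 / (2 * h ^ 2))
  have i2 := (integrable_barkerDensity_mul_one_sub_sq hh x).const_mul
      (h ^ 2 / 2 * (inner ℝ x u) ^ 2)
  have := integral_mono (integrable_barkerDensity_mul_inner_score_sq hh h1' x u) (i1.add i2)
    (barkerDensity_mul_inner_score_sq_le hh h1' x u)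
  simp only [Pi.add_apply] at this
  rw [integral_add i1 i2, integral_const_mul, integral_const_mul,
    integral_gaussianDensity_mul_inner_sq hh] at this
  refine this.trans ?_
  have e1 : (inner ℝ x u) ^ 2 ≤ ‖x‖ ^ 2 * ‖u‖ ^ 2 := by
    rw [← mul_pow, ← sq_abs]
    exact pow_le_pow_left₀ (abs_nonneg _) (abs_real_inner_le_norm x u) 2
  have e2 := integral_barkerDensity_mul_one_sub_sq_le hh h1' x
  have e3 := sq_norm_mul_min_inverseRatioMean_le hh h1 hn x
  have hm : 0 ≤ min 1 (inverseRatioMean h x) :=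
    le_min zero_le_one (inverseRatioMean_pos hh h1' x).le
  -- The proposal part contributes `1/h` and the acceptance part `(1/2) · (8/h)`, which makes `5/h`.
  calc _ ≤ 1 / (2 * h ^ 2) * (2 * h * ‖u‖ ^ 2)
        + h ^ 2 / 2 * (‖x‖ ^ 2 * ‖u‖ ^ 2) * min 1 (inverseRatioMean h x) := by
        gcongr
        exact integral_nonneg fun w => mul_nonneg (barkerDensity_pos hh x w).le (sq_nonneg _)
    _ = ‖u‖ ^ 2 / h + 1 / 2 * ‖u‖ ^ 2 * (h ^ 2 * ‖x‖ ^ 2 * min 1 (inverseRatioMean h x)) := by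
        field_simp
    _ ≤ ‖u‖ ^ 2 / h + 1 / 2 * ‖u‖ ^ 2 * (8 / h) := by gcongr
    _ = 5 / h * ‖u‖ ^ 2 := by ring

end Barker

/-! ### Differentiating integrals against the Barker density. -/

section Smoothing

variable {E : Type*} [NormedAddCommGroup E] [InnerProductSpace ℝ E] [FiniteDimensional ℝ E]
  [MeasurableSpace E] [BorelSpace E]

theorem hasFDerivAt_barkerDensity {h : ℝ} (hh : 0 < h) (x w : E) :
    HasFDerivAt (fun x => barkerDensity h x w)
      (barkerDensity h x w • innerSL ℝ (barkerScore h x w)) x := by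
  set T : E → ℝ := fun x => Real.exp (h / 4 * (‖w‖ ^ 2 - ‖x‖ ^ 2))
  have hTpos : ∀ x, 0 < 1 + T x := fun x => by positivity
  have d0 : HasFDerivAt (fun x : E => ‖x‖ ^ 2) (2 • innerSL ℝ x) x :=
    (hasStrictFDerivAt_norm_sq x).hasFDerivAt
  have d1 : HasFDerivAt T (T x • (h / 4) • (-(2 • innerSL ℝ x) : E →L[ℝ] ℝ)) x :=
    ((d0.const_sub (‖w‖ ^ 2)).const_mul (h / 4)).exp
  have d2 : HasFDerivAt (fun x => barkerProb h x w)
      ((-((1 + T x) ^ 2)⁻¹) • (T x • (h / 4) • (-(2 • innerSL ℝ x) : E →L[ℝ] ℝ))) x :=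
    (hasDerivAt_inv (hTpos x).ne').comp_hasFDerivAt x (d1.const_add 1)
  have d3 : HasFDerivAt (fun x : E => w - (1 - h) • x)
      (-((1 - h) • ContinuousLinearMap.id ℝ E)) x :=
    ((hasFDerivAt_id x).const_smul (1 - h)).const_sub w
  have d4 : HasFDerivAt (fun x : E => ‖w - (1 - h) • x‖ ^ 2)
      ((2 • innerSL ℝ (w - (1 - h) • x)).comp (-((1 - h) • ContinuousLinearMap.id ℝ E))) x :=
    HasFDerivAt.comp (g := fun v : E => ‖v‖ ^ 2) x
      (hasStrictFDerivAt_norm_sq (w - (1 - h) • x)).hasFDerivAt d3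
  have d5 := ((d4.const_mul (-1 / (2 * (2 * h)))).exp.const_mul
    ((2 * Real.pi * (2 * h)) ^ ((Module.finrank ℝ E : ℝ) / 2))⁻¹).mul d2
  have hfun : (fun x => barkerDensity h x w) = fun x =>
      ((2 * Real.pi * (2 * h)) ^ ((Module.finrank ℝ E : ℝ) / 2))⁻¹ *
        Real.exp (-1 / (2 * (2 * h)) * ‖w - (1 - h) • x‖ ^ 2) * barkerProb h x w := by
    funext x
    unfold barkerDensity gaussianDensity
    congr 3
    ring
  rw [hfun]
  refine d5.congr_fderiv ?_
  have hp : barkerProb h x w = (1 + T x)⁻¹ := rfl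
  ext u
  -- The logistic identity `p' = p (1 - p)`: it lets the Barker density factor out of its own
  -- derivative, leaving the score.
  have e1 : (((1 + T x) ^ 2)⁻¹ * T x) = (1 + T x)⁻¹ * (1 - (1 + T x)⁻¹) := by
    have := hTpos x
    field_simp
    ring
  have hb : barkerDensity h x w = ((2 * Real.pi * (2 * h)) ^ ((Module.finrank ℝ E : ℝ) / 2))⁻¹ *
      Real.exp (-1 / (2 * (2 * h)) * ‖w - (1 - h) • x‖ ^ 2) * (1 + T x)⁻¹ :=
    congrFun hfun x
  simp only [add_apply, smul_apply,
    ContinuousLinearMap.comp_apply, neg_apply, ContinuousLinearMap.id_apply,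
    innerSL_apply_apply, smul_eq_mul, nsmul_eq_mul, hb, hp, barkerScore, inner_add_left,
    inner_smul_left, inner_smul_right, inner_neg_right, conj_trivial]
  push_cast
  set c := ((2 * Real.pi * (2 * h)) ^ ((Module.finrank ℝ E : ℝ) / 2))⁻¹
  set e := Real.exp (-1 / (2 * (2 * h)) * ‖w - (1 - h) • x‖ ^ 2)
  set a : ℝ := inner ℝ (w - (1 - h) • x) u
  set b : ℝ := inner ℝ x u
  have e2 : -1 / (2 * (2 * h)) * (2 * -((1 - h) * a)) = (1 - h) / (2 * h) * a := by
    field_simp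
  linear_combination (c * e * (h / 2) * b) * e1 + (c * e * (1 + T x)⁻¹) * e2

theorem norm_barkerScore_le {h : ℝ} (hh : 0 < h) (h1 : h < 1) (x w : E) :
    ‖barkerScore h x w‖ ≤ 1 / (2 * h) * ‖w - (1 - h) • x‖ + h / 2 * ‖x‖ := by
  unfold barkerScore
  refine (norm_add_le _ _).trans (add_le_add ?_ ?_)
  · rw [norm_smul, Real.norm_eq_abs, abs_of_nonneg (div_nonneg (by linarith) (by positivity))]
    gcongr
    linarith
  · have h2 : 0 ≤ 1 - barkerProb h x w := by linarith [barkerProb_le_one h x w]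
    rw [norm_smul, Real.norm_eq_abs, abs_of_nonneg (mul_nonneg h2 (by positivity))]
    refine mul_le_mul_of_nonneg_right ?_ (norm_nonneg _)
    exact mul_le_of_le_one_left (by positivity) (by linarith [barkerProb_pos h x w])

/-- A locally uniform integrable bound on the derivative of `barkerDensity`. -/
theorem exists_bound_barkerDensity_smul_score {h : ℝ} (hh : 0 < h) (h1 : h < 1) (x₀ : E) :
    ∃ b : E → ℝ, Integrable b ∧ ∀ w, ∀ x ∈ Metric.ball x₀ 1,
      ‖barkerDensity h x w • innerSL ℝ (barkerScore h x w)‖ ≤ b w := by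
  set c : ℝ := ((2 * Real.pi * (2 * h)) ^ ((Module.finrank ℝ E : ℝ) / 2))⁻¹ with hc
  set K : ℝ := 1 / (2 * h) * (1 + 2 * h) + h / 2 * (‖x₀‖ + 1) with hK
  refine ⟨fun w => c * K * Real.exp (1 / (8 * h)) *
    Real.exp (-(1 / (16 * h)) * ‖w - (1 - h) • x₀‖ ^ 2), ?_, ?_⟩
  · exact ((integrable_exp_neg_mul_sq_norm (by positivity)).comp_sub_right _).const_mul _
  · intro w x hx
    have hxx : ‖x - x₀‖ ≤ 1 := by
      rw [← dist_eq_norm]; exact (Metric.mem_ball.1 hx).le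
    have hxn : ‖x‖ ≤ ‖x₀‖ + 1 := by
      have := norm_add_le x₀ (x - x₀)
      rw [add_sub_cancel] at this
      linarith
    set v := w - (1 - h) • x with hv
    set v₀ := w - (1 - h) • x₀ with hv₀
    have hvv : ‖v₀‖ ≤ ‖v‖ + 1 := by
      have e : v₀ = v + (1 - h) • (x - x₀) := by rw [hv, hv₀]; module
      rw [e]
      refine (norm_add_le _ _).trans (add_le_add_right ?_ _)
      rw [norm_smul, Real.norm_eq_abs, abs_of_nonneg (by linarith)]
      nlinarith [norm_nonneg (x - x₀)]
    have hvsq : ‖v₀‖ ^ 2 / 2 - 1 ≤ ‖v‖ ^ 2 := by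
      nlinarith [norm_nonneg v, norm_nonneg v₀, sq_nonneg (‖v‖ - 1)]
    -- The proposal density is a constant times `exp (-2 t)`. One factor `exp (-t)` absorbs the
    -- linear growth of the score; the other, compared with the centre `x₀` through `‖v₀‖² ≤ 2 ‖v‖²
    -- + 2`, remains as an integrable bound.
    set t := ‖v‖ ^ 2 / (8 * h) with ht
    have ht0 : 0 ≤ t := by positivity
    have hvt : ‖v‖ ≤ (1 + 2 * h) * Real.exp t := by
      have e1 : ‖v‖ ≤ t + 2 * h := by
        have : t + 2 * h - ‖v‖ = (‖v‖ - 4 * h) ^ 2 / (8 * h) := by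
          rw [ht]; field_simp; ring
        have : 0 ≤ (‖v‖ - 4 * h) ^ 2 / (8 * h) := by positivity
        linarith
      have e2 := Real.add_one_le_exp t
      nlinarith [mul_nonneg hh.le ht0]
    have h1t : 1 ≤ Real.exp t := Real.one_le_exp ht0
    have hscore : ‖barkerScore h x w‖ ≤ K * Real.exp t := by
      refine (norm_barkerScore_le hh h1 x w).trans ?_
      calc 1 / (2 * h) * ‖v‖ + h / 2 * ‖x‖
          ≤ 1 / (2 * h) * ((1 + 2 * h) * Real.exp t)
            + h / 2 * ((‖x₀‖ + 1) * Real.exp t) := by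
            gcongr
            exact hxn.trans (le_mul_of_one_le_right (by positivity) h1t)
        _ = K * Real.exp t := by rw [hK]; ring
    have hq : gaussianDensity (2 * h) v = c * (Real.exp (-t) * Real.exp (-t)) := by
      rw [gaussianDensity, ← Real.exp_add, hc, ht]
      congr 2
      field_simp
      ring
    have hexp : Real.exp (-t) ≤ Real.exp (1 / (8 * h)) *
        Real.exp (-(1 / (16 * h)) * ‖v₀‖ ^ 2) := by
      rw [← Real.exp_add]
      refine Real.exp_le_exp.2 ?_
      have e : 1 / (8 * h) + -(1 / (16 * h)) * ‖v₀‖ ^ 2 = -((‖v₀‖ ^ 2 / 2 - 1) / (8 * h)) := by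
        field_simp
        ring
      rw [e, ht]
      exact neg_le_neg (div_le_div_of_nonneg_right hvsq (by positivity))
    rw [norm_smul, innerSL_apply_norm, Real.norm_eq_abs, abs_of_pos (barkerDensity_pos hh x w)]
    calc barkerDensity h x w * ‖barkerScore h x w‖
        ≤ (c * (Real.exp (-t) * Real.exp (-t))) * (K * Real.exp t) := by
          rw [← hq]
          exact mul_le_mul (barkerDensity_le_gaussianDensity hh x w) hscore (norm_nonneg _)
            (gaussianDensity_pos (by positivity) _).le
      _ = c * K * Real.exp (-t) * (Real.exp (-t) * Real.exp t) := by ring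
      _ = c * K * Real.exp (-t) := by rw [← Real.exp_add]; simp
      _ ≤ c * K * (Real.exp (1 / (8 * h)) * Real.exp (-(1 / (16 * h)) * ‖v₀‖ ^ 2)) := by
          gcongr
      _ = _ := by ring

/-- The unnormalized average of `f` over the Barker moves from `x`. -/
def barkerSum (h : ℝ) (f : E → ℝ) (x : E) : ℝ := ∫ w, barkerDensity h x w * f w

theorem integrable_barkerSum_deriv {h : ℝ} (hh : 0 < h) (h1 : h < 1) {f : E → ℝ}
    (hf : Measurable f) {M : ℝ} (hM : ∀ x, |f x| ≤ M) (x : E) :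
    Integrable fun w => f w • (barkerDensity h x w • innerSL ℝ (barkerScore h x w)) := by
  obtain ⟨b, hb, hbd⟩ := exists_bound_barkerDensity_smul_score hh h1 x
  refine Integrable.mono' (hb.const_mul M) ?_ (ae_of_all _ fun w => ?_)
  · have h2 : Measurable fun w => innerSL ℝ (barkerScore h x w) :=
      (innerSL ℝ : E →L[ℝ] E →L[ℝ] ℝ).continuous.measurable.comp (measurable_barkerScore_right h x)
    exact (hf.smul ((measurable_barkerDensity_right h x).smul h2)).aestronglyMeasurable
  · rw [norm_smul, Real.norm_eq_abs]
    exact mul_le_mul (hM w) (hbd w x (Metric.mem_ball_self one_pos)) (norm_nonneg _)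
      ((abs_nonneg _).trans (hM w))

theorem hasFDerivAt_barkerSum {h : ℝ} (hh : 0 < h) (h1 : h < 1) {f : E → ℝ}
    (hf : Measurable f) {M : ℝ} (hM : ∀ x, |f x| ≤ M) (x : E) :
    HasFDerivAt (barkerSum h f)
      (∫ w, f w • (barkerDensity h x w • innerSL ℝ (barkerScore h x w))) x := by
  obtain ⟨b, hb, hbd⟩ := exists_bound_barkerDensity_smul_score hh h1 x
  refine hasFDerivAt_integral_of_dominated_of_fderiv_le (𝕜 := ℝ) (bound := fun w => M * b w)
    (F' := fun y w => f w • (barkerDensity h y w • innerSL ℝ (barkerScore h y w)))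
    (Metric.ball_mem_nhds x one_pos) ?_ ?_ ?_ ?_ (hb.const_mul M) ?_
  · exact Filter.Eventually.of_forall fun y =>
      ((measurable_barkerDensity_right h y).mul hf).aestronglyMeasurable
  · exact integrable_barkerDensity_mul hh x hf hM
  · exact (integrable_barkerSum_deriv hh h1 hf hM x).aestronglyMeasurable
  · refine ae_of_all _ fun w y hy => ?_
    rw [norm_smul, Real.norm_eq_abs]
    exact mul_le_mul (hM w) (hbd w y hy) (norm_nonneg _) ((abs_nonneg _).trans (hM w))
  · refine ae_of_all _ fun w y _ => ?_
    exact (hasFDerivAt_barkerDensity hh y w).mul_const (f w)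

/-- Cauchy–Schwarz with weight `b`: the quadratic `s ↦ ∫ b (s p - q)²` is nonnegative, so its
discriminant is not positive. -/
theorem sq_integral_mul_mul_le {α : Type*} [MeasurableSpace α] {μ : Measure α} {b p q : α → ℝ}
    (hb : ∀ x, 0 ≤ b x) (hp : Integrable (fun x => b x * p x ^ 2) μ)
    (hq : Integrable (fun x => b x * q x ^ 2) μ) (hpq : Integrable (fun x => b x * (p x * q x)) μ) :
    (∫ x, b x * (p x * q x) ∂μ) ^ 2
      ≤ (∫ x, b x * p x ^ 2 ∂μ) * ∫ x, b x * q x ^ 2 ∂μ := by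
  have h : ∀ s : ℝ, 0 ≤ (∫ x, b x * p x ^ 2 ∂μ) * (s * s)
      + (-(2 * ∫ x, b x * (p x * q x) ∂μ)) * s + ∫ x, b x * q x ^ 2 ∂μ := by
    intro s
    have h0 : 0 ≤ ∫ x, b x * (s * p x - q x) ^ 2 ∂μ :=
      integral_nonneg fun x => mul_nonneg (hb x) (sq_nonneg _)
    have e : (fun x => b x * (s * p x - q x) ^ 2)
        = fun x => (s * s) * (b x * p x ^ 2) - (2 * s * (b x * (p x * q x)) - b x * q x ^ 2) := by
      funext x; ring
    rw [e, integral_sub (hp.const_mul _) (by exact (hpq.const_mul _).sub hq),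
      integral_sub (hpq.const_mul _) hq, integral_const_mul, integral_const_mul] at h0
    linarith
  have := discrim_le_zero h
  rw [discrim] at this
  linarith

/-- The average of `f` over the Barker moves from `x`. -/
def barkerAverage (h : ℝ) (f : E → ℝ) (x : E) : ℝ := barkerSum h f x / barkerMass h x

/-- The local Dirichlet energy of the Barker moves from `x`. -/
def barkerEnergy (h : ℝ) (f : E → ℝ) (x : E) : ℝ := ∫ w, barkerDensity h x w * (f w - f x) ^ 2

end Smoothing

/-! ### Gradient of the Barker average and the approximate Poincaré inequality. -/

section Smoothing

variable {E : Type*} [NormedAddCommGroup E] [InnerProductSpace ℝ E] [FiniteDimensional ℝ E]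
  [MeasurableSpace E] [BorelSpace E]

theorem hasFDerivAt_barkerAverage {h : ℝ} (hh : 0 < h) (h1 : h < 1) {f : E → ℝ}
    (hf : Measurable f) {M : ℝ} (hM : ∀ x, |f x| ≤ M) (x : E) :
    HasFDerivAt (barkerAverage h f) ((barkerMass h x)⁻¹ •
      ((∫ w, f w • (barkerDensity h x w • innerSL ℝ (barkerScore h x w)))
        - barkerAverage h f x • ∫ w, (1 : ℝ) • (barkerDensity h x w • innerSL ℝ (barkerScore h x w))))
      x := by
  have hm := barkerMass_pos hh h1 x
  have d1 := hasFDerivAt_barkerSum hh h1 hf hM x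
  have d2 := hasFDerivAt_barkerSum hh h1 (f := fun _ : E => (1 : ℝ)) measurable_const (M := 1)
    (by simp) x
  have hmass : barkerSum h (fun _ : E => (1 : ℝ)) = barkerMass h := by
    funext y
    simp [barkerSum, barkerMass]
  rw [hmass] at d2
  have d3 := d1.mul ((hasDerivAt_inv hm.ne').comp_hasFDerivAt x d2)
  refine d3.congr_fderiv ?_
  ext u
  simp only [add_apply, smul_apply, sub_apply, smul_eq_mul, Function.comp_apply, barkerAverage]
  field_simp
  ring

/-- In the quotient rule the derivative of the mass enters multiplied by the average, so `f` appears
centred at that average. This is what allows the energy, and not merely the size of `f`, to control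
the gradient. -/
theorem fderiv_barkerAverage_apply {h : ℝ} (hh : 0 < h) (h1 : h < 1) {f : E → ℝ}
    (hf : Measurable f) {M : ℝ} (hM : ∀ x, |f x| ≤ M) (x u : E) :
    fderiv ℝ (barkerAverage h f) x u = (barkerMass h x)⁻¹ *
      ∫ w, barkerDensity h x w * (inner ℝ (barkerScore h x w) u * (f w - barkerAverage h f x)) := by
  have i1 := integrable_barkerSum_deriv hh h1 hf hM x
  have i2 := integrable_barkerSum_deriv hh h1 (f := fun _ : E => (1 : ℝ)) measurable_const (M := 1)
    (by simp) x
  rw [(hasFDerivAt_barkerAverage hh h1 hf hM x).fderiv, smul_apply, sub_apply, smul_apply,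
    ContinuousLinearMap.integral_apply i1, ContinuousLinearMap.integral_apply i2, smul_eq_mul,
    smul_eq_mul, ← integral_const_mul, ← integral_sub (i1.apply_continuousLinearMap u)
      ((i2.apply_continuousLinearMap u).const_mul _)]
  congr 1
  refine integral_congr_ae (ae_of_all _ fun w => ?_)
  simp only [smul_apply, smul_eq_mul, innerSL_apply_apply]
  ring

theorem integrable_barkerDensity_mul_sub_sq {h : ℝ} (hh : 0 < h) {f : E → ℝ}
    (hf : Measurable f) {M : ℝ} (hM : ∀ x, |f x| ≤ M) (x : E) (a : ℝ) :
    Integrable fun w => barkerDensity h x w * (f w - a) ^ 2 := by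
  refine integrable_barkerDensity_mul hh x (M := (M + |a|) ^ 2) (by fun_prop) fun w => ?_
  rw [abs_pow]
  exact pow_le_pow_left₀ (abs_nonneg _) ((abs_sub _ _).trans (by linarith [hM w])) 2

/-- Bias and variance: the cross term vanishes since `a` is the mean of `f` under the normalized
Barker moves. The first summand will bound the gradient of the average, the second its distance to
`f`. -/
theorem barkerEnergy_eq {h : ℝ} (hh : 0 < h) (h1 : h < 1) {f : E → ℝ}
    (hf : Measurable f) {M : ℝ} (hM : ∀ x, |f x| ≤ M) (x : E) :
    barkerEnergy h f x = (∫ w, barkerDensity h x w * (f w - barkerAverage h f x) ^ 2)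
      + barkerMass h x * (f x - barkerAverage h f x) ^ 2 := by
  set a := barkerAverage h f x with ha
  have hm := barkerMass_pos hh h1 x
  have hsum : ∫ w, barkerDensity h x w * f w = a * barkerMass h x := by
    rw [ha, barkerAverage, div_mul_cancel₀ _ hm.ne']
    rfl
  have i1 := integrable_barkerDensity_mul_sub_sq hh hf hM x a
  have i2 := integrable_barkerDensity_mul hh x hf hM
  have i3 := integrable_barkerDensity hh x
  have e : (fun w => barkerDensity h x w * (f w - f x) ^ 2)
      = fun w => barkerDensity h x w * (f w - a) ^ 2
        + (2 * (a - f x) * (barkerDensity h x w * f w)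
          - (a - f x) * (a + f x) * barkerDensity h x w) := by
    funext w; ring
  rw [barkerEnergy, e, integral_add i1 (by exact (i2.const_mul _).sub (i3.const_mul _)),
    integral_sub (i2.const_mul _) (i3.const_mul _), integral_const_mul, integral_const_mul, hsum,
    show ∫ w, barkerDensity h x w = barkerMass h x from rfl]
  ring

theorem barkerMass_mul_sq_le_barkerEnergy {h : ℝ} (hh : 0 < h) (h1 : h < 1) {f : E → ℝ}
    (hf : Measurable f) {M : ℝ} (hM : ∀ x, |f x| ≤ M) (x : E) :
    barkerMass h x * (f x - barkerAverage h f x) ^ 2 ≤ barkerEnergy h f x := by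
  rw [barkerEnergy_eq hh h1 hf hM]
  exact le_add_of_nonneg_left (integral_nonneg fun w =>
    mul_nonneg (barkerDensity_pos hh x w).le (sq_nonneg _))

theorem barkerEnergy_nonneg {h : ℝ} (hh : 0 < h) (f : E → ℝ) (x : E) : 0 ≤ barkerEnergy h f x :=
  integral_nonneg fun w => mul_nonneg (barkerDensity_pos hh x w).le (sq_nonneg _)

/-- Cauchy–Schwarz between the score, whose second moment is the Fisher information bound `5/h`, and
the centred `f`, whose second moment is at most the energy. The squared mass comes from the
normalization. -/
theorem sq_norm_fderiv_barkerAverage_le {h : ℝ} (hh : 0 < h) (h1 : h ≤ 1 / 4)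
    (hn : h ^ 3 * Module.finrank ℝ E ≤ 1) {f : E → ℝ}
    (hf : Measurable f) {M : ℝ} (hM : ∀ x, |f x| ≤ M) (x : E) :
    ‖fderiv ℝ (barkerAverage h f) x‖ ^ 2
      ≤ 5 / h * barkerEnergy h f x / barkerMass h x ^ 2 := by
  have h1' : h < 1 := by linarith
  have hm := barkerMass_pos hh h1' x
  set a := barkerAverage h f x with ha
  have hE0 := barkerEnergy_nonneg hh f x
  have hC : 0 ≤ 5 / h * barkerEnergy h f x / barkerMass h x ^ 2 := by positivity
  have i1 := integrable_barkerSum_deriv hh h1' hf hM x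
  have i2 := integrable_barkerSum_deriv hh h1' (f := fun _ : E => (1 : ℝ)) measurable_const
    (M := 1) (by simp) x
  have hvar : ∫ w, barkerDensity h x w * (f w - a) ^ 2 ≤ barkerEnergy h f x := by
    rw [barkerEnergy_eq hh h1' hf hM]
    exact le_add_of_nonneg_right (mul_nonneg hm.le (sq_nonneg _))
  have hu : ∀ u, (fderiv ℝ (barkerAverage h f) x u) ^ 2
      ≤ 5 / h * barkerEnergy h f x / barkerMass h x ^ 2 * ‖u‖ ^ 2 := by
    intro u
    have hpq : Integrable fun w => barkerDensity h x w
        * (inner ℝ (barkerScore h x w) u * (f w - a)) := by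
      refine ((i1.apply_continuousLinearMap u).sub
        ((i2.apply_continuousLinearMap u).const_mul a)).congr (ae_of_all _ fun w => ?_)
      simp only [Pi.sub_apply, smul_apply, smul_eq_mul, innerSL_apply_apply]
      ring
    have hCS := sq_integral_mul_mul_le (fun w => (barkerDensity_pos hh x w).le)
      (integrable_barkerDensity_mul_inner_score_sq hh h1' x u)
      (integrable_barkerDensity_mul_sub_sq hh hf hM x a) hpq
    have hF := integral_barkerDensity_mul_inner_score_sq_le hh h1 hn x u
    rw [fderiv_barkerAverage_apply hh h1' hf hM, mul_pow, ← ha]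
    calc _ ≤ (barkerMass h x)⁻¹ ^ 2 * (5 / h * ‖u‖ ^ 2 * barkerEnergy h f x) := by
          refine mul_le_mul_of_nonneg_left (hCS.trans ?_) (sq_nonneg _)
          refine mul_le_mul hF hvar (integral_nonneg fun w =>
            mul_nonneg (barkerDensity_pos hh x w).le (sq_nonneg _)) (by positivity)
      _ = _ := by
          field_simp
  have hop : ‖fderiv ℝ (barkerAverage h f) x‖
      ≤ Real.sqrt (5 / h * barkerEnergy h f x / barkerMass h x ^ 2) := by
    refine ContinuousLinearMap.opNorm_le_bound _ (Real.sqrt_nonneg _) fun u => ?_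
    rw [Real.norm_eq_abs]
    refine abs_le_of_sq_le_sq ?_ (by positivity)
    rw [mul_pow, Real.sq_sqrt hC]
    exact hu u
  calc _ ≤ Real.sqrt (5 / h * barkerEnergy h f x / barkerMass h x ^ 2) ^ 2 :=
        pow_le_pow_left₀ (norm_nonneg _) hop 2
    _ = _ := Real.sq_sqrt hC

/-- The factor of the mass matters: on the exceptional set it cancels one of the two inverse masses
in the gradient bound. -/
theorem barkerEnergy_le {h : ℝ} (hh : 0 < h) {f : E → ℝ}
    (hf : Measurable f) {M : ℝ} (hM : ∀ x, f x ∈ Set.Icc 0 M) (x : E) :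
    barkerEnergy h f x ≤ M ^ 2 * barkerMass h x := by
  have hi := integrable_barkerDensity_mul_sub_sq hh hf (abs_le_of_mem_Icc hM) x (f x)
  rw [barkerMass, ← integral_const_mul]
  refine integral_mono hi ((integrable_barkerDensity hh x).const_mul _) fun w => ?_
  simp only
  rw [mul_comm]
  refine mul_le_mul_of_nonneg_right ?_ (barkerDensity_pos hh x w).le
  exact sq_le_sq.2 ((abs_le.2 ⟨by linarith [(hM w).1, (hM x).2], by linarith [(hM w).2, (hM x).1]⟩ :
    |f w - f x| ≤ M).trans (le_abs_self M))

theorem barkerAverage_mem_Icc {h : ℝ} (hh : 0 < h) (h1 : h < 1) {f : E → ℝ}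
    (hf : Measurable f) {M : ℝ} (hM : ∀ x, f x ∈ Set.Icc 0 M) (x : E) :
    barkerAverage h f x ∈ Set.Icc 0 M := by
  have hm := barkerMass_pos hh h1 x
  refine ⟨div_nonneg (integral_nonneg fun w =>
    mul_nonneg (barkerDensity_pos hh x w).le (hM w).1) hm.le, ?_⟩
  rw [barkerAverage, div_le_iff₀ hm, barkerMass, ← integral_const_mul]
  refine integral_mono (integrable_barkerDensity_mul hh x hf (abs_le_of_mem_Icc hM))
    ((integrable_barkerDensity hh x).const_mul _) fun w => ?_
  simp only
  rw [mul_comm]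
  exact mul_le_mul_of_nonneg_right (hM w).2 (barkerDensity_pos hh x w).le

theorem measurable_barkerEnergy (h : ℝ) {f : E → ℝ} (hf : Measurable f) :
    Measurable (barkerEnergy h f) := by
  have h0 := (continuous_barkerDensity (E := E) h).measurable
  have h1 : Measurable fun p : E × E => barkerDensity h p.1 p.2 * (f p.2 - f p.1) ^ 2 := by
    fun_prop
  exact (h1.stronglyMeasurable.integral_prod_right' (ν := volume)).measurable

theorem integral_exp_neg_mul_sq_norm_stdGaussian {t : ℝ} (ht : 0 ≤ t) :
    ∫ x, Real.exp (-t * ‖x‖ ^ 2) ∂(stdGaussian E)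
      = ((1 + 2 * t) ^ ((Module.finrank ℝ E : ℝ) / 2))⁻¹ := by
  have h0 : ∀ x : E, gaussianDensity 1 x * Real.exp (-t * ‖x‖ ^ 2)
      = ((2 * Real.pi) ^ ((Module.finrank ℝ E : ℝ) / 2))⁻¹
        * Real.exp (-(1 / 2 + t) * ‖x‖ ^ 2) := by
    intro x
    rw [gaussianDensity, mul_assoc, ← Real.exp_add, mul_one]
    congr 2
    ring
  have h1 : (0 : ℝ) < 2 * Real.pi := by positivity
  rw [integral_stdGaussian_eq]
  simp_rw [h0]
  rw [integral_const_mul, GaussianFourier.integral_rexp_neg_mul_sq_norm (by positivity),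
    ← Real.inv_rpow h1.le, ← Real.mul_rpow (by positivity) (by positivity),
    ← Real.inv_rpow (by positivity)]
  congr 1
  field_simp

/-- Lower tail of the squared norm of a standard Gaussian vector. -/
theorem stdGaussian_sq_norm_lt_le {L : ℝ} (hn : 0 < Module.finrank ℝ E) (hL : 0 ≤ L) :
    (stdGaussian E).real {x | ‖x‖ ^ 2 < Module.finrank ℝ E - L}
      ≤ Real.exp (-(L ^ 2 / (4 * Module.finrank ℝ E))) := by
  set n : ℝ := (Module.finrank ℝ E : ℝ) with hndef
  have hn0 : 0 < n := by rw [hndef]; exact_mod_cast hn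
  -- Chernoff's method: this `t` minimizes `n t² - L t`, the exponent obtained from `log (1 + 2 t) ≥
  -- 2 t - 2 t²`.
  set t : ℝ := L / (2 * n) with ht
  have ht0 : 0 ≤ t := by positivity
  have hS : MeasurableSet {x : E | ‖x‖ ^ 2 < n - L} :=
    measurableSet_lt (by fun_prop) measurable_const
  have hi : Integrable (fun x : E => Real.exp (t * (n - L)) * Real.exp (-t * ‖x‖ ^ 2))
      (stdGaussian E) := by
    refine Integrable.const_mul (integrable_of_abs_le (by fun_prop) (M := 1) fun x => ?_) _
    rw [abs_of_pos (Real.exp_pos _)]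
    exact Real.exp_le_one_iff.2 (by
      have : 0 ≤ t * ‖x‖ ^ 2 := by positivity
      linarith)
  have h1 : (stdGaussian E).real {x : E | ‖x‖ ^ 2 < n - L}
      ≤ Real.exp (t * (n - L)) * ((1 + 2 * t) ^ (n / 2))⁻¹ := by
    rw [← integral_exp_neg_mul_sq_norm_stdGaussian ht0, ← integral_const_mul,
      ← integral_indicator_one hS]
    refine integral_mono ((integrable_const (1 : ℝ)).indicator hS) hi fun x => ?_
    by_cases hx : x ∈ {x : E | ‖x‖ ^ 2 < n - L}
    · rw [Set.indicator_of_mem hx, ← Real.exp_add]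
      refine Real.one_le_exp ?_
      have : ‖x‖ ^ 2 < n - L := hx
      nlinarith
    · rw [Set.indicator_of_notMem hx]
      positivity
  refine h1.trans ?_
  have h2 : 2 * t - 2 * t ^ 2 ≤ Real.log (1 + 2 * t) := by
    refine le_trans ?_ (Real.le_log_one_add_of_nonneg (by positivity : 0 ≤ 2 * t))
    rw [le_div_iff₀ (by positivity)]
    nlinarith [pow_nonneg ht0 3]
  rw [← Real.rpow_neg (by positivity), Real.rpow_def_of_pos (by positivity), ← Real.exp_add]
  refine Real.exp_le_exp.2 ?_
  have h3 : t * (n - L) + (2 * t - 2 * t ^ 2) * -(n / 2) = -(L ^ 2 / (4 * n)) := by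
    rw [ht]
    field_simp
    ring
  nlinarith

theorem integral_sub_const_sq {α : Type*} [MeasurableSpace α] {μ : Measure α}
    [IsProbabilityMeasure μ] {f : α → ℝ} (hf : Integrable f μ)
    (hf2 : Integrable (fun x => f x ^ 2) μ) (a : ℝ) :
    ∫ x, (f x - a) ^ 2 ∂μ = ∫ x, f x ^ 2 ∂μ - 2 * a * (∫ x, f x ∂μ) + a ^ 2 := by
  have e : (fun x => (f x - a) ^ 2) = fun x => f x ^ 2 - (2 * a * f x - a ^ 2) := by
    funext x; ring
  rw [e, integral_sub hf2 (by exact (hf.const_mul _).sub (integrable_const _)),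
    integral_sub (hf.const_mul _) (integrable_const _), integral_const_mul, integral_const,
    probReal_univ, one_smul]
  ring

/-- The variance of `f` is at most its second moment about the mean `a` of `g`, and `(f - a)² ≤ 2 (f
- g)² + 2 (g - a)²`. -/
theorem variance_le_two_mul_add {α : Type*} [MeasurableSpace α] {μ : Measure α}
    [IsProbabilityMeasure μ] {f g : α → ℝ} (hf : Integrable f μ)
    (hf2 : Integrable (fun x => f x ^ 2) μ) (hg : Integrable g μ)
    (hg2 : Integrable (fun x => g x ^ 2) μ) (hfg : Integrable (fun x => (f x - g x) ^ 2) μ) :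
    ∫ x, f x ^ 2 ∂μ - (∫ x, f x ∂μ) ^ 2
      ≤ 2 * ∫ x, (f x - g x) ^ 2 ∂μ + 2 * (∫ x, g x ^ 2 ∂μ - (∫ x, g x ∂μ) ^ 2) := by
  obtain ⟨a, ha⟩ : ∃ a, a = ∫ x, g x ∂μ := ⟨_, rfl⟩
  have i1 : Integrable (fun x => (f x - a) ^ 2) μ := by
    refine ((hf2.sub (hf.const_mul (2 * a))).add (integrable_const (a ^ 2))).congr
      (ae_of_all _ fun x => ?_)
    simp only [Pi.add_apply, Pi.sub_apply]
    ring
  have i2 : Integrable (fun x => (g x - a) ^ 2) μ := by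
    refine ((hg2.sub (hg.const_mul (2 * a))).add (integrable_const (a ^ 2))).congr
      (ae_of_all _ fun x => ?_)
    simp only [Pi.add_apply, Pi.sub_apply]
    ring
  have h := integral_mono i1 ((hfg.const_mul 2).add (i2.const_mul 2)) fun x => by
    simp only [Pi.add_apply]
    nlinarith [sq_nonneg (f x - g x - (g x - a))]
  simp only [Pi.add_apply] at h
  rw [integral_add (hfg.const_mul 2) (i2.const_mul 2), integral_const_mul, integral_const_mul,
    integral_sub_const_sq hf hf2, integral_sub_const_sq hg hg2, ← ha] at h
  rw [← ha]
  nlinarith [sq_nonneg ((∫ x, f x ∂μ) - a)]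

/-- An approximate Poincaré inequality for the energy of the Barker moves. -/
theorem variance_le_barkerEnergy {h L : ℝ} (hh : 0 < h) (h1 : h ≤ 1 / 4)
    (hn0 : 0 < Module.finrank ℝ E) (hn : h ^ 3 * Module.finrank ℝ E ≤ 1) (hL : 0 ≤ L) {f : E → ℝ}
    (hf : Measurable f) {M : ℝ} (hM : ∀ x, f x ∈ Set.Icc 0 M) :
    ∫ x, f x ^ 2 ∂(stdGaussian E) - (∫ x, f x ∂(stdGaussian E)) ^ 2
      ≤ 13 / h * (1 + Real.exp (1 + h ^ 2 * L / 2)) ^ 2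
          * ∫ x, barkerEnergy h f x ∂(stdGaussian E)
        + 13 / h * (1 + Real.exp (h ^ 2 * Module.finrank ℝ E))
          * Real.exp (-(L ^ 2 / (4 * Module.finrank ℝ E))) * M ^ 2 := by
  have h1' : h < 1 := by linarith
  set γ := stdGaussian E
  set n : ℝ := (Module.finrank ℝ E : ℝ) with hndef
  set g := barkerAverage h f with hg
  set D := barkerEnergy h f with hD
  set S := 1 + Real.exp (1 + h ^ 2 * L / 2) with hS
  set A := 1 + Real.exp (h ^ 2 * n) with hA
  set bad : Set E := {x | ‖x‖ ^ 2 < n - L} with hbad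
  have hbadm : MeasurableSet bad := measurableSet_lt (by fun_prop) measurable_const
  have hfM := abs_le_of_mem_Icc hM
  have hgI := barkerAverage_mem_Icc hh h1' hf hM
  have hgM := abs_le_of_mem_Icc hgI
  have hd : Differentiable ℝ g := fun x =>
    (hasFDerivAt_barkerAverage hh h1' hf hfM x).differentiableAt
  have hgm : Measurable g := hd.continuous.measurable
  have hD0 : ∀ x, 0 ≤ D x := barkerEnergy_nonneg hh f
  have hm0 : ∀ x, 0 < barkerMass h x := fun x : E => barkerMass_pos hh h1' x
  have hm1 : ∀ x, barkerMass h x ≤ 1 := fun x : E => by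
    rw [← integral_gaussianDensity_sub hh x]
    exact integral_mono (integrable_barkerDensity hh x) (integrable_gaussianDensity_sub hh x)
      (barkerDensity_le_gaussianDensity hh x)
  have hDM : ∀ x, D x ≤ M ^ 2 * barkerMass h x := barkerEnergy_le hh hf hM
  have hmA : ∀ x, (barkerMass h x)⁻¹ ≤ A := fun x : E =>
    inv_le_of_inv_le₀ (by positivity) ((inv_anti₀ (by
      linarith [inverseRatioMean_pos hh h1' x]) (by
        linarith [inverseRatioMean_le_exp_finrank hh h1 x])).trans
      (inv_one_add_inverseRatioMean_le_barkerMass hh h1' x))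
  have hmS : ∀ x, x ∉ bad → (barkerMass h x)⁻¹ ≤ S := fun x hx =>
    inv_le_of_inv_le₀ (by positivity) ((inv_anti₀ (by
      linarith [inverseRatioMean_pos hh h1' x]) (by
        have e1 := inverseRatioMean_le_of_le_sq_norm hh h1 x (not_lt.1 hx) hL
        have e2 : Real.exp (h ^ 3 * Module.finrank ℝ E + h ^ 2 * L / 2)
          ≤ Real.exp (1 + h ^ 2 * L / 2) := Real.exp_le_exp.2 (by linarith)
        linarith)).trans
      (inv_one_add_inverseRatioMean_le_barkerMass hh h1' x))
  have hgrad : ∀ x, ‖fderiv ℝ g x‖ ^ 2 ≤ 5 / h * D x / barkerMass h x ^ 2 :=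
    sq_norm_fderiv_barkerAverage_le hh h1 hn hf hfM
  have hDm2 : ∀ x, D x / barkerMass h x ^ 2 ≤ M ^ 2 * A := fun x => by
    calc D x / barkerMass h x ^ 2 ≤ M ^ 2 * barkerMass h x / barkerMass h x ^ 2 := by
          gcongr
          exact hDM x
      _ = M ^ 2 * (barkerMass h x)⁻¹ := by
          have := hm0 x
          field_simp
      _ ≤ M ^ 2 * A := by gcongr; exact hmA x
  have hgradB : ∀ x, ‖fderiv ℝ g x‖ ^ 2 ≤ 5 / h * (M ^ 2 * A) := fun x => by
    refine (hgrad x).trans ?_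
    rw [mul_div_assoc]
    gcongr
    exact hDm2 x
  have hP := variance_le_integral_fderiv_sq hd
    (fun x => Real.le_sqrt_of_sq_le (hgradB x)) hgM
  have hmono : ∀ {u : E → ℝ}, (∀ x, |u x| ≤ M) → ∀ x, |u x ^ 2| ≤ M ^ 2 := fun hu x => by
    rw [abs_pow]; exact pow_le_pow_left₀ (abs_nonneg _) (hu x) 2
  have if1 : Integrable f γ := integrable_of_abs_le hf hfM
  have if2 : Integrable (fun x => f x ^ 2) γ :=
    integrable_of_abs_le (hf.pow_const 2) (hmono hfM)
  have ig1 : Integrable g γ := integrable_of_abs_le hgm hgM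
  have ig2 : Integrable (fun x => g x ^ 2) γ :=
    integrable_of_abs_le (hgm.pow_const 2) (hmono hgM)
  have ifg : Integrable (fun x => (f x - g x) ^ 2) γ :=
    integrable_of_abs_le ((hf.sub hgm).pow_const 2) (hmono fun x => abs_le.2
      ⟨by linarith [(hM x).1, (hgI x).2], by linarith [(hM x).2, (hgI x).1]⟩)
  have igrad : Integrable (fun x => ‖fderiv ℝ g x‖ ^ 2) γ :=
    integrable_of_abs_le (((measurable_fderiv ℝ g).norm).pow_const 2) fun x => by
      rw [abs_of_nonneg (sq_nonneg _)]; exact hgradB x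
  have iD : Integrable D γ := by
    refine integrable_of_abs_le (measurable_barkerEnergy h hf) (M := M ^ 2) fun x => ?_
    rw [abs_of_nonneg (hD0 x)]
    exact (hDM x).trans (mul_le_of_le_one_right (sq_nonneg _) (hm1 x))
  have hvar : ∫ x, f x ^ 2 ∂γ - (∫ x, f x ∂γ) ^ 2
      ≤ 2 * ∫ x, (f x - g x) ^ 2 ∂γ + 2 * (∫ x, g x ^ 2 ∂γ - (∫ x, g x ∂γ) ^ 2) :=
    variance_le_two_mul_add if1 if2 ig1 ig2 ifg
  -- This turns `π²/8` into `5/4`; doubled by the variance comparison it is the coefficient `5/2`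
  -- below.
  have hpi : Real.pi ^ 2 ≤ 10 := by nlinarith [Real.pi_lt_d2, Real.pi_pos]
  have hpt : ∀ x, 2 * (f x - g x) ^ 2 + 5 / 2 * ‖fderiv ℝ g x‖ ^ 2
      ≤ 13 / h * S ^ 2 * D x + 13 / h * A * M ^ 2 * bad.indicator 1 x := by
    intro x
    have hm := hm0 x
    have e1 : (f x - g x) ^ 2 ≤ D x / barkerMass h x ^ 2 := by
      rw [le_div_iff₀ (by positivity)]
      have := barkerMass_mul_sq_le_barkerEnergy hh h1' hf hfM x
      nlinarith [hm1 x, sq_nonneg (f x - g x), mul_le_mul_of_nonneg_left (hm1 x) hm.le]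
    -- From `h ≤ 1/4` the first coefficient is at most `1 / (2 h)`; adding `(5/2) · (5/h)` gives
    -- `13/h`.
    have e2 : 2 * (f x - g x) ^ 2 + 5 / 2 * ‖fderiv ℝ g x‖ ^ 2
        ≤ 13 / h * (D x / barkerMass h x ^ 2) := by
      have e3 := hgrad x
      rw [mul_div_assoc] at e3
      have e4 : 2 ≤ 1 / 2 / h := by rw [le_div_iff₀ hh]; linarith
      calc _ ≤ 1 / 2 / h * (D x / barkerMass h x ^ 2)
            + 5 / 2 * (5 / h * (D x / barkerMass h x ^ 2)) := by gcongr
        _ = 13 / h * (D x / barkerMass h x ^ 2) := by ring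
    refine e2.trans ?_
    by_cases hx : x ∈ bad
    · rw [Set.indicator_of_mem hx, Pi.one_apply, mul_one]
      have e6 : 13 / h * (D x / barkerMass h x ^ 2) ≤ 13 / h * (M ^ 2 * A) := by
        gcongr
        exact hDm2 x
      have e7 : 0 ≤ 13 / h * S ^ 2 * D x := mul_nonneg (by positivity) (hD0 x)
      linarith
    · rw [Set.indicator_of_notMem hx, mul_zero, add_zero, mul_assoc]
      refine mul_le_mul_of_nonneg_left ?_ (by positivity)
      rw [div_eq_inv_mul, ← inv_pow]
      exact mul_le_mul_of_nonneg_right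
        (pow_le_pow_left₀ (inv_nonneg.2 hm.le) (hmS x hx) 2) (hD0 x)
  have iind : Integrable (bad.indicator (1 : E → ℝ)) γ :=
    (integrable_const (1 : ℝ)).indicator hbadm
  have hint := integral_mono ((ifg.const_mul 2).add (igrad.const_mul (5 / 2)))
    ((iD.const_mul (13 / h * S ^ 2)).add (iind.const_mul (13 / h * A * M ^ 2))) hpt
  simp only [Pi.add_apply] at hint
  rw [integral_add (ifg.const_mul 2) (igrad.const_mul (5 / 2)),
    integral_add (iD.const_mul _) (iind.const_mul _), integral_const_mul, integral_const_mul,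
    integral_const_mul, integral_const_mul, integral_indicator_one hbadm] at hint
  have htail : γ.real bad ≤ Real.exp (-(L ^ 2 / (4 * n))) := stdGaussian_sq_norm_lt_le hn0 hL
  have hgi0 : 0 ≤ ∫ x, ‖fderiv ℝ g x‖ ^ 2 ∂γ := integral_nonneg fun x => sq_nonneg _
  have hfin : 13 / h * A * M ^ 2 * γ.real bad
      ≤ 13 / h * A * Real.exp (-(L ^ 2 / (4 * n))) * M ^ 2 := by
    rw [mul_right_comm _ (Real.exp _)]
    gcongr
  have hP2 : ∫ x, g x ^ 2 ∂γ - (∫ x, g x ∂γ) ^ 2 ≤ 5 / 4 * ∫ x, ‖fderiv ℝ g x‖ ^ 2 ∂γ :=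
    hP.trans (mul_le_mul_of_nonneg_right (by linarith) hgi0)
  linarith

end Smoothing

/-! ### From the energy bound to the convergence of MALA, and the choice of parameters. -/

section Mixing

variable {d : ℕ}

theorem integral_barkerEnergy_le_dirichletForm {h : ℝ} (hh : 0 < h)
    {f : EuclideanSpace ℝ (Fin d) → ℝ} (hf : Measurable f) {M : ℝ}
    (hM : ∀ x, f x ∈ Set.Icc 0 M) :
    ∫ x, barkerEnergy h f x ∂(stdGaussian (EuclideanSpace ℝ (Fin d)))
      ≤ 2 * dirichletForm (stdGaussian (EuclideanSpace ℝ (Fin d))) (gaussianKernel d h) f := by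
  have := isMarkovKernel_gaussianKernel (d := d) hh
  have hfM := abs_le_of_mem_Icc hM
  have hsq : ∀ x y, (f y - f x) ^ 2 ≤ M ^ 2 := fun x y => by
    rw [← sq_abs]
    exact pow_le_pow_left₀ (abs_nonneg _) (abs_le.2
      ⟨by linarith [(hM x).2, (hM y).1], by linarith [(hM x).1, (hM y).2]⟩) 2
  have hi : Integrable (fun p : EuclideanSpace ℝ (Fin d) × EuclideanSpace ℝ (Fin d) =>
      (f p.2 - f p.1) ^ 2)
      (stdGaussian (EuclideanSpace ℝ (Fin d)) ⊗ₘ gaussianKernel d h) :=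
    integrable_of_abs_le (by fun_prop) (M := M ^ 2) fun p => by
      rw [abs_of_nonneg (sq_nonneg _)]; exact hsq _ _
  have hpt : ∀ x, barkerEnergy h f x ≤ ∫ y, (f y - f x) ^ 2 ∂(gaussianKernel d h x) := by
    intro x
    refine le_trans ?_ (integral_acceptedDensity_mul_le hh x (F := fun y => (f y - f x) ^ 2)
      (by fun_prop) (fun _ => sq_nonneg _) (hsq x))
    refine integral_mono (integrable_barkerDensity_mul_sub_sq hh hf hfM x (f x))
      (integrable_acceptedDensity_mul hh x (M := M ^ 2) (by fun_prop) fun y => by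
        rw [abs_of_nonneg (sq_nonneg _)]; exact hsq _ _) fun y => ?_
    exact mul_le_mul_of_nonneg_right (barkerDensity_le_acceptedDensity hh x y) (sq_nonneg _)
  rw [dirichletForm, ← mul_assoc, show (2 : ℝ) * (1 / 2) = 1 by norm_num, one_mul]
  exact integral_mono_of_nonneg (ae_of_all _ fun x => barkerEnergy_nonneg hh f x)
    hi.integral_compProd (ae_of_all _ hpt)

theorem tvDist_law_gaussianKernel_le {h L M ρ : ℝ} (hd : 0 < d) (hh : 0 < h) (h1 : h ≤ 1 / 4)
    (hn : h ^ 3 * d ≤ 1) (hL : 0 ≤ L)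
    (hρ : ρ = h / (26 * (1 + Real.exp (1 + h ^ 2 * L / 2)) ^ 2))
    {μ₀ : Measure (EuclideanSpace ℝ (Fin d))} [IsProbabilityMeasure μ₀]
    (hw : IsWarm M μ₀ (stdGaussian (EuclideanSpace ℝ (Fin d)))) (n : ℕ) :
    tvDist (law (gaussianKernel d h) μ₀ n) (stdGaussian (EuclideanSpace ℝ (Fin d)))
      ≤ Real.sqrt ((1 - ρ) ^ n * M ^ 2 + 13 / h * (1 + Real.exp (h ^ 2 * d))
        * Real.exp (-(L ^ 2 / (4 * d))) * M ^ 2) := by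
  have := isMarkovKernel_gaussianKernel (d := d) hh
  set S := 1 + Real.exp (1 + h ^ 2 * L / 2) with hS
  have hS1 : 1 ≤ S := by linarith [Real.exp_pos (1 + h ^ 2 * L / 2)]
  have hρ0 : 0 < ρ := by rw [hρ]; positivity
  have hρ1 : ρ ≤ 1 := by
    rw [hρ, div_le_one (by positivity)]
    nlinarith
  have hfin : Module.finrank ℝ (EuclideanSpace ℝ (Fin d)) = d := finrank_euclideanSpace_fin
  refine tvDist_law_le (isReversible_gaussianKernel hh)
    (fun F hF hb => integral_mul_kernelMap_gaussianKernel_nonneg hh (by linarith) hF hb)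
    hρ1 (by positivity) (fun f hf hM => ?_) hw n
  have hv := variance_le_barkerEnergy hh h1 (by rw [hfin]; exact hd) (by rw [hfin]; exact hn)
    hL hf hM
  rw [hfin, ← hS] at hv
  have hE := integral_barkerEnergy_le_dirichletForm hh hf hM
  -- The factor 26 in `ρ` is chosen for this: the Barker energy is at most twice the Dirichlet form.
  have hρS : ρ * (13 / h * S ^ 2) = 1 / 2 := by
    rw [hρ]
    field_simp
    norm_num
  have := mul_le_mul_of_nonneg_left hv hρ0.le
  rw [mul_add, ← mul_assoc, hρS] at this
  linarith

/-- The inequality `4 (1 - 1/M) ≤ M` is `(M/2 - 1)² ≥ 0`. Unless the start is already mixed, `M / ε`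
thus exceeds 4. -/
theorem four_mul_lt_of_lt_one_sub {M ε : ℝ} (hM : 1 ≤ M) (h : ε < 1 - 1 / M) : 4 * ε < M := by
  have hM0 : 0 < M := by linarith
  have h1 : (1 - 1 / M) ≤ M / 4 := by
    rw [sub_le_iff_le_add, ← sub_le_iff_le_add', le_div_iff₀ hM0]
    nlinarith [sq_nonneg (M / 2 - 1)]
  linarith

/-- Here `r` is the cube root of the dimension and `L = B r²`, so the tail is `exp (-(4 + 2 |K|)
r)`. It pays for `13 ≤ exp (3 r)`, for `exp r` from the crude mass bound, and for `exp (2 K r)` from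
`M²`. The hypothesis bounds `M` by `ε h exp (K r)`; its `h²` after squaring beats the factor `1/h`.
-/
theorem defect_le {c K r h B M ε : ℝ} (hr : 1 ≤ r) (hh : h = c / r) (hh0 : 0 < h)
    (h1 : h ≤ 1 / 4) (hc1 : c ≤ 1) (hB : B ^ 2 = 16 + 8 * |K|) (hε : 0 < ε) (hM : 0 < M)
    (hlog : Real.log (M / (ε * h)) ≤ K * r) :
    13 / h * (1 + Real.exp (h ^ 2 * r ^ 3)) * Real.exp (-((B * r ^ 2) ^ 2 / (4 * r ^ 3))) * M ^ 2
      ≤ ε ^ 2 / 2 := by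
  have hr0 : 0 < r := by linarith
  have hc0 : 0 < c := by
    have : c = h * r := by rw [hh]; field_simp
    rw [this]; positivity
  have hMle : M ≤ ε * h * Real.exp (K * r) := by
    have := (Real.log_le_iff_le_exp (by positivity)).1 hlog
    rwa [div_le_iff₀ (by positivity), mul_comm] at this
  have e1 : h ^ 2 * r ^ 3 ≤ r := by
    rw [hh]
    have : (c / r) ^ 2 * r ^ 3 = c ^ 2 * r := by field_simp
    rw [this]
    exact mul_le_of_le_one_left hr0.le (pow_le_one₀ hc0.le hc1)
  have e2 : 1 + Real.exp (h ^ 2 * r ^ 3) ≤ 2 * Real.exp r := by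
    have := Real.exp_le_exp.2 e1
    have := Real.one_le_exp hr0.le
    linarith
  have e3 : (B * r ^ 2) ^ 2 / (4 * r ^ 3) = (4 + 2 * |K|) * r := by
    rw [mul_pow, hB]
    field_simp
    ring
  have e4 : (13 : ℝ) ≤ Real.exp (3 * r) := by
    have h0 : Real.exp 1 ^ 3 = Real.exp (3 * 1) := by rw [← Real.exp_nat_mul]; norm_num
    have h2 : (2.5 : ℝ) ≤ Real.exp 1 := by linarith [Real.exp_one_gt_d9]
    have h3 : (2.5 : ℝ) ^ 3 ≤ Real.exp 1 ^ 3 := pow_le_pow_left₀ (by norm_num) h2 3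
    have h4 : Real.exp (3 * 1) ≤ Real.exp (3 * r) := Real.exp_le_exp.2 (by linarith)
    linarith
  rw [e3]
  calc 13 / h * (1 + Real.exp (h ^ 2 * r ^ 3)) * Real.exp (-((4 + 2 * |K|) * r)) * M ^ 2
      ≤ Real.exp (3 * r) / h * (2 * Real.exp r) * Real.exp (-((4 + 2 * |K|) * r))
          * (ε * h * Real.exp (K * r)) ^ 2 := by gcongr
    _ = 2 * h * ε ^ 2 * (Real.exp (3 * r) * Real.exp r * Real.exp (-((4 + 2 * |K|) * r))
          * Real.exp (K * r) * Real.exp (K * r)) := by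
        field_simp
    _ = 2 * h * ε ^ 2 * Real.exp (2 * (K - |K|) * r) := by
        rw [← Real.exp_add, ← Real.exp_add, ← Real.exp_add, ← Real.exp_add]
        congr 2
        ring
    _ ≤ 2 * h * ε ^ 2 * 1 := by
        gcongr
        refine Real.exp_le_one_iff.2 ?_
        have := le_abs_self K
        nlinarith
    _ ≤ ε ^ 2 / 2 := by nlinarith [sq_nonneg ε]

theorem contraction_le {ρ M ε : ℝ} {n : ℕ} (hρ0 : 0 < ρ) (hρ1 : ρ ≤ 1) (hε : 0 < ε)
    (h4 : 4 * ε < M) (hn : 3 * Real.log (M / ε) / ρ ≤ n) :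
    (1 - ρ) ^ n * M ^ 2 ≤ ε ^ 2 / 2 := by
  have hM : 0 < M := by linarith
  rw [div_le_iff₀ hρ0] at hn
  have h1 : (1 - ρ) ^ n ≤ Real.exp (-(3 * Real.log (M / ε))) := by
    calc (1 - ρ) ^ n ≤ Real.exp (-ρ) ^ n :=
          pow_le_pow_left₀ (by linarith) (by linarith [Real.add_one_le_exp (-ρ)]) n
      _ = Real.exp (n * -ρ) := (Real.exp_nat_mul _ _).symm
      _ ≤ _ := Real.exp_le_exp.2 (by linarith)
  -- Two powers cancel `M²`; the third leaves a spare `ε / M ≤ 1/2`.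
  have h2 : Real.exp (-(3 * Real.log (M / ε))) = (ε / M) ^ 3 := by
    rw [Real.exp_neg, mul_comm, Real.exp_mul, Real.exp_log (by positivity)]
    norm_cast
    rw [← inv_pow, inv_div]
  rw [h2] at h1
  calc (1 - ρ) ^ n * M ^ 2 ≤ (ε / M) ^ 3 * M ^ 2 := by gcongr
    _ = ε ^ 2 * (ε / M) := by field_simp
    _ ≤ ε ^ 2 * (1 / 2) := by
        refine mul_le_mul_of_nonneg_left ?_ (sq_nonneg ε)
        rw [div_le_iff₀ hM]
        linarith
    _ = ε ^ 2 / 2 := by ring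

end Mixing

end MALA

end

/-! ### The mixing time bound. -/

theorem mainTheorem5 :
    ∃ c₀ : ℝ, 0 < c₀ ∧ ∀ c : ℝ, 0 < c → c ≤ c₀ → ∀ K : ℝ, ∃ C : ℝ, 0 < C ∧
      ∀ (d : ℕ), 1 ≤ d → ∀ (ε M₀ h : ℝ), 0 < ε → ε ≤ M₀ → h = c * (d : ℝ) ^ (-(1 / 3) : ℝ) →
      ∀ (μ₀ : Measure (EuclideanSpace ℝ (Fin d))), IsProbabilityMeasure μ₀ →
        MALA.IsWarm M₀ μ₀ (stdGaussian (EuclideanSpace ℝ (Fin d))) →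
        Real.log (M₀ / (ε * h)) ≤ K * (d : ℝ) ^ (1 / 3 : ℝ) →
        ∃ n : ℕ,
          MALA.mixingTime (MALA.gaussianKernel d h) (stdGaussian (EuclideanSpace ℝ (Fin d))) μ₀ ε
            = n ∧
          (n : ℝ) ≤ C * (d : ℝ) ^ (1 / 3 : ℝ) * Real.log (M₀ / ε) := by
  refine ⟨1 / 4, by norm_num, fun c hc hc1 K => ?_⟩
  set B : ℝ := Real.sqrt (16 + 8 * |K|) with hB
  have hB2 : B ^ 2 = 16 + 8 * |K| := Real.sq_sqrt (by positivity)
  -- Since `h² L = c² B`, this bound on the inverse Barker mass does not depend on the dimension.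
  set S : ℝ := 1 + Real.exp (1 + c ^ 2 * B / 2) with hS
  have hS1 : 1 ≤ S := by linarith [Real.exp_pos (1 + c ^ 2 * B / 2)]
  refine ⟨104 * S ^ 2 / c, by positivity, ?_⟩
  intro d hd ε M h hε hεM hhd μ₀ hμ hw hlog
  have hM0 : 0 < M := hε.trans_le hεM
  have hd0 : (1 : ℝ) ≤ d := by exact_mod_cast hd
  set r : ℝ := (d : ℝ) ^ (1 / 3 : ℝ) with hr
  have hr1 : 1 ≤ r := Real.one_le_rpow hd0 (by norm_num)
  have hr0 : 0 < r := by linarith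
  have hr3 : r ^ 3 = d := by
    rw [hr, ← Real.rpow_natCast, ← Real.rpow_mul (by positivity)]
    norm_num
  have hh : h = c / r := by
    rw [hhd, Real.rpow_neg (by positivity), ← hr]
    rfl
  have hh0 : 0 < h := by rw [hh]; positivity
  have hhc : h ≤ c := by rw [hh]; exact div_le_self hc.le hr1
  have hh1 : h ≤ 1 / 4 := hhc.trans hc1
  have hlog0 : 0 ≤ Real.log (M / ε) := Real.log_nonneg ((one_le_div hε).2 hεM)
  -- When `log (M / ε)` is close to 0 the bound may leave no room for even one step. In this case
  -- the initial law is already within `ε`, and `n = 0` works.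
  by_cases htriv : 1 - 1 / M ≤ ε
  · obtain ⟨n, hn, hn0⟩ := MALA.exists_mixingTime_eq (T := MALA.gaussianKernel d h) (N := 0)
      ((MALA.tvDist_le_of_isWarm hw).trans htriv)
    refine ⟨n, hn, ?_⟩
    rw [Nat.le_zero.1 hn0, Nat.cast_zero]
    positivity
  · have h4 := MALA.four_mul_lt_of_lt_one_sub hw.one_le (not_le.1 htriv)
    -- From `M / ε > 4 > e`. It absorbs the `+ 1` of the ceiling into a fourth multiple of `log (M /
    -- ε) / ρ`, whence `104 = 4 · 26`.
    have hlog1 : 1 ≤ Real.log (M / ε) := by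
      rw [Real.le_log_iff_exp_le (by positivity), le_div_iff₀ hε]
      nlinarith [Real.exp_one_lt_d9]
    have hL : h ^ 2 * (B * r ^ 2) = c ^ 2 * B := by
      rw [hh]
      field_simp
    set ρ : ℝ := h / (26 * S ^ 2) with hρ
    have hρ0 : 0 < ρ := by positivity
    have hρ1 : ρ ≤ 1 := by
      rw [hρ, div_le_one (by positivity)]
      nlinarith
    have hh3 : h ^ 3 * d ≤ 1 := by
      rw [← hr3, hh, ← mul_pow, div_mul_cancel₀ _ hr0.ne']
      exact pow_le_one₀ hc.le (by linarith)
    set N : ℕ := ⌈3 * Real.log (M / ε) / ρ⌉₊ with hN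
    have hNge : 3 * Real.log (M / ε) / ρ ≤ N := Nat.le_ceil _
    have hNle : (N : ℝ) ≤ 3 * Real.log (M / ε) / ρ + 1 := (Nat.ceil_lt_add_one (by positivity)).le
    have htv := MALA.tvDist_law_gaussianKernel_le (L := B * r ^ 2) (ρ := ρ) hd hh0 hh1 hh3
      (by positivity) (by rw [hL]) hw N
    have hsmall := MALA.contraction_le hρ0 hρ1 hε h4 hNge
    have hdef := MALA.defect_le hr1 hh hh0 hh1 (by linarith) hB2 hε hM0 hlog
    rw [hr3] at hdef
    have hfinal : MALA.tvDist (MALA.law (MALA.gaussianKernel d h) μ₀ N)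
        (stdGaussian (EuclideanSpace ℝ (Fin d))) ≤ ε :=
      htv.trans ((Real.sqrt_le_sqrt (by linarith)).trans_eq (Real.sqrt_sq hε.le))
    obtain ⟨n, hn, hn0⟩ := MALA.exists_mixingTime_eq hfinal
    refine ⟨n, hn, ?_⟩
    calc (n : ℝ) ≤ N := by exact_mod_cast hn0
      _ ≤ 3 * Real.log (M / ε) / ρ + 1 := hNle
      _ ≤ 3 * Real.log (M / ε) / ρ + Real.log (M / ε) / ρ := by
          gcongr
          rw [le_div_iff₀ hρ0]
          linarith
      _ = 104 * S ^ 2 / c * r * Real.log (M / ε) := by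
          rw [hρ, hh]
          field_simp
          ring
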